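/- Conventions. A local language $L$ is a (possibly many-sorted) first-order language without function symbols other than constants, equipped, for each single sort $s$, with a partially ordered monoid $D^s$ of binary relation symbols on $s$ (the locality relation symbols), whose identity is the equality symbol of $s$ and is the least element of $D^s$, and with a function assigning to each pair of constants $c_1,c_2$ of the same sort a locality relation symbol $B_{c_1,c_2}$ on that sort. We write $|L|$ for the number of formulas of $L$, i.e. the maximum of $\aleph_0$ and the number of symbols of $L$, and $|M|$ for the total number of elements of a structure $M$; all sorts of a structure are non-empty. A local structure is an $L$-structure in which (A1) locality relations are symmetric; (A2) $d_1\preceq d_2$ implies $d_1\subseteq d_2$; (A3) $d_1\circ d_2\subseteq d_1*d_2$; (A4) $B_{c_1,c_2}(c_1,c_2)$ holds for all constants $c_1,c_2$ of the same sort; (A5) any two elements of the same sort are related by some locality relation. Positive formulas are built from atomic formulas by conjunction, disjunction and existential quantification; negative sentences are negations of positive sentences. A negative local theory is a set $T$ of negative sentences that contains every negative sentence true in all local models of $T$ (local models are local structures satisfying $T$). A positively closed (pc) model of $T$ is a local model $M$ of $T$ such that every homomorphism $f\colon M\to N$ to a local model $N$ of $T$ is a positive embedding, i.e. $N\models\varphi(f(a))$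 implies $M\models\varphi(a)$ for every positive formula $\varphi$ and tuple $a$ of $M$. A retractor of $T$ is a local model $C$ of $T$ such that every homomorphism $f\colon C\to N$ to a local model $N$ of $T$ has a retraction, i.e. a homomorphism $g\colon N\to C$ with $g\circ f=\mathrm{id}$. Two local models of $T$ are compatible if both admit homomorphisms to a common local model of $T$. We say that $T$ has retractors if every local model of $T$ is compatible with some retractor of $T$. Statement. Let $L$ be a local language and $T$ a negative local theory in $L$ that has a local model. Then $|C|\le 2^{|L|}$ for every retractor $C$ of $T$. Moreover, the following are equivalent: (1) $T$ has retractors; (2) there is a cardinal $\kappa$ such that $|M|<\kappa$ for every pc model $M$ of $T$; (3) $|M|\le 2^{|L|}$ for every pc model $M$ of $T$. -/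

import Mathlib

universe u

/-- A local first-order language: a many-sorted relational language with constants, together with
a partially ordered monoid of binary *locality relation symbols* on each single sort, whose identity
is the equality symbol of the sort and is the least element, and a bound function on pairs of
constants of the same sort. `Rel ar` is the type of relation symbols of sort `ar` that are not
locality relation symbols. -/
structure LocalLanguage where
  Sorts : Type u
  Const : Sorts → Type u
  Rel : List Sorts → Type u
  Loc : Sorts → Type u
  [locMonoid : ∀ s, Monoid (Loc s)]
  [locOrder : ∀ s, PartialOrder (Loc s)]
  loc_one_le : ∀ (s : Sorts) (d : Loc s), 1 ≤ d
  loc_mul_le_mul : ∀ (s : Sorts) (d₁ d₂ e₁ e₂ : Loc s), d₁ ≤ d₂ → e₁ ≤ e₂ → d₁ * e₁ ≤ d₂ * e₂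
  bound : ∀ {s : Sorts}, Const s → Const s → Loc s

namespace LocalLanguage

attribute [instance] LocalLanguage.locMonoid LocalLanguage.locOrder

/-- The cardinality of the language: the number of its formulas, that is, the number of its symbols
(the equality symbol of each sort included, as a locality relation symbol) if that is infinite,
and `ℵ₀` otherwise. -/
noncomputable def card (L : LocalLanguage.{u}) : Cardinal.{u} :=
  max Cardinal.aleph0
    (Cardinal.mk ((Σ s, L.Const s) ⊕ (Σ ar, L.Rel ar) ⊕ (Σ s, L.Loc s)))

/-- Variables of sort `s` in a finite context `Γ` (a list of sorts, one for each variable). -/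
inductive Var {S : Type u} : List S → S → Type u
  | zero {Γ : List S} {s : S} : Var (s :: Γ) s
  | succ {Γ : List S} {s t : S} : Var Γ s → Var (t :: Γ) s

/-- Terms of sort `s` with variables in `Γ`. -/
inductive Term (L : LocalLanguage.{u}) (Γ : List L.Sorts) (s : L.Sorts) : Type u
  | var : Var Γ s → Term L Γ s
  | const : L.Const s → Term L Γ s

/-- Positive formulas with free variables in `Γ`. Equality of terms is `loc 1 t₁ t₂`. -/
inductive PosFormula (L : LocalLanguage.{u}) : List L.Sorts → Type u
  | rel {Γ : List L.Sorts} {ar : List L.Sorts} (R : L.Rel ar)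
      (t : (i : Fin ar.length) → Term L Γ (ar.get i)) : PosFormula L Γ
  | loc {Γ : List L.Sorts} {s : L.Sorts} (d : L.Loc s) (t₁ t₂ : Term L Γ s) : PosFormula L Γ
  | and {Γ : List L.Sorts} (φ ψ : PosFormula L Γ) : PosFormula L Γ
  | or {Γ : List L.Sorts} (φ ψ : PosFormula L Γ) : PosFormula L Γ
  | ex {Γ : List L.Sorts} (s : L.Sorts) (φ : PosFormula L (s :: Γ)) : PosFormula L Γ

/-- Negative sentences: `⟨φ⟩` stands for the negation of the positive sentence `φ`. -/
structure NegSentence (L : LocalLanguage.{u}) where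
  body : PosFormula L []

/-- An `L`-structure (with non-empty sorts, as usual in first-order logic); the locality symbol `1`
of each sort is interpreted as equality. -/
structure Struc (L : LocalLanguage.{u}) where
  carrier : L.Sorts → Type u
  [nonempty_carrier : ∀ s, Nonempty (carrier s)]
  const : ∀ {s : L.Sorts}, L.Const s → carrier s
  rel : ∀ {ar : List L.Sorts}, L.Rel ar → ((i : Fin ar.length) → carrier (ar.get i)) → Prop
  loc : ∀ {s : L.Sorts}, L.Loc s → carrier s → carrier s → Prop
  loc_one : ∀ {s : L.Sorts} (a b : carrier s), loc 1 a b ↔ a = b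

variable {L : LocalLanguage.{u}}

namespace Struc

/-- The cardinality of a many-sorted structure: the total number of its elements. -/
noncomputable def card (M : Struc L) : Cardinal.{u} := Cardinal.mk (Σ s, M.carrier s)

/-- Tuples of elements of `M` indexed by the variables of `Γ`, of the right sorts. -/
def Env (M : Struc L) (Γ : List L.Sorts) : Type u := ∀ s : L.Sorts, Var Γ s → M.carrier s

def Env.nil (M : Struc L) : M.Env [] := fun _ x => nomatch x

def Env.cons {M : Struc L} {Γ : List L.Sorts} {s : L.Sorts} (a : M.carrier s) (v : M.Env Γ) :
    M.Env (s :: Γ)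
  | _, .zero => a
  | _, .succ x => v _ x

/-- The value of a term at a tuple. -/
def eval (M : Struc L) {Γ : List L.Sorts} (v : M.Env Γ) {s : L.Sorts} : Term L Γ s → M.carrier s
  | .var x => v s x
  | .const c => M.const c

/-- `M.Sat φ v`: the structure `M` satisfies the positive formula `φ` at the tuple `v`. -/
def Sat (M : Struc L) : {Γ : List L.Sorts} → PosFormula L Γ → M.Env Γ → Prop
  | _, .rel R t, v => M.rel R (fun i => M.eval v (t i))
  | _, .loc d t₁ t₂, v => M.loc d (M.eval v t₁) (M.eval v t₂)
  | _, .and φ ψ, v => M.Sat φ v ∧ M.Sat ψ v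
  | _, .or φ ψ, v => M.Sat φ v ∨ M.Sat ψ v
  | _, .ex s φ, v => ∃ a : M.carrier s, M.Sat φ (Env.cons a v)

/-- Satisfaction of a negative sentence. -/
def SatNeg (M : Struc L) (σ : NegSentence L) : Prop := ¬ M.Sat σ.body (Env.nil M)

/-- Local structures: the locality axioms. -/
structure IsLocal (M : Struc L) : Prop where
  symm : ∀ {s : L.Sorts} (d : L.Loc s) (a b : M.carrier s), M.loc d a b → M.loc d b a
  mono : ∀ {s : L.Sorts} (d₁ d₂ : L.Loc s), d₁ ≤ d₂ →
    ∀ a b : M.carrier s, M.loc d₁ a b → M.loc d₂ a b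
  comp : ∀ {s : L.Sorts} (d₁ d₂ : L.Loc s) (a b c : M.carrier s),
    M.loc d₁ a b → M.loc d₂ b c → M.loc (d₁ * d₂) a c
  bound : ∀ {s : L.Sorts} (c₁ c₂ : L.Const s), M.loc (L.bound c₁ c₂) (M.const c₁) (M.const c₂)
  exists_loc : ∀ {s : L.Sorts} (a b : M.carrier s), ∃ d : L.Loc s, M.loc d a b

/-- Homomorphisms of `L`-structures. -/
structure Hom (M N : Struc L) where
  toFun : ∀ s : L.Sorts, M.carrier s → N.carrier s
  map_const : ∀ {s : L.Sorts} (c : L.Const s), toFun s (M.const c) = N.const c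
  map_rel : ∀ {ar : List L.Sorts} (R : L.Rel ar) (a : (i : Fin ar.length) → M.carrier (ar.get i)),
    M.rel R a → N.rel R (fun i => toFun _ (a i))
  map_loc : ∀ {s : L.Sorts} (d : L.Loc s) (a b : M.carrier s),
    M.loc d a b → N.loc d (toFun s a) (toFun s b)

/-- The image of a tuple under a homomorphism. -/
def Hom.mapEnv {M N : Struc L} (f : Hom M N) {Γ : List L.Sorts} (v : M.Env Γ) : N.Env Γ :=
  fun s x => f.toFun s (v s x)

/-- A homomorphism is a positive embedding if it reflects satisfaction of positive formulas. -/
def Hom.IsPosEmbedding {M N : Struc L} (f : Hom M N) : Prop :=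
  ∀ (Γ : List L.Sorts) (φ : PosFormula L Γ) (v : M.Env Γ), N.Sat φ (f.mapEnv v) → M.Sat φ v

/-- `g` is a retraction of `f`, i.e. `g ∘ f = id`. -/
def Hom.IsRetraction {M N : Struc L} (g : Hom N M) (f : Hom M N) : Prop :=
  ∀ (s : L.Sorts) (a : M.carrier s), g.toFun s (f.toFun s a) = a

end Struc

open Struc

/-- `M` is a local model of the set `T` of negative sentences. -/
def IsLocalModel (T : Set (NegSentence L)) (M : Struc L) : Prop :=
  M.IsLocal ∧ ∀ σ ∈ T, M.SatNeg σ

/-- `T` is locally satisfiable. -/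
def LocallySatisfiable (T : Set (NegSentence L)) : Prop := ∃ M : Struc L, IsLocalModel T M

/-- A negative local theory: a set of negative sentences closed under local implication. -/
def IsNegLocalTheory (T : Set (NegSentence L)) : Prop :=
  ∀ σ : NegSentence L, (∀ M : Struc L, IsLocalModel T M → M.SatNeg σ) → σ ∈ T

/-- `M` is a local positively closed model of `T`. -/
def IsPCModel (T : Set (NegSentence L)) (M : Struc L) : Prop :=
  IsLocalModel T M ∧ ∀ N : Struc L, IsLocalModel T N → ∀ f : Hom M N, f.IsPosEmbedding

/-- `C` is a (local) retractor of `T`. -/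
def IsRetractor (T : Set (NegSentence L)) (C : Struc L) : Prop :=
  IsLocalModel T C ∧
    ∀ N : Struc L, IsLocalModel T N → ∀ f : Hom C N, ∃ g : Hom N C, g.IsRetraction f

/-- `A` and `B` are compatible in `T`: both map homomorphically to a common local model of `T`. -/
def Compatible (T : Set (NegSentence L)) (A B : Struc L) : Prop :=
  ∃ M : Struc L, IsLocalModel T M ∧ Nonempty (Hom A M) ∧ Nonempty (Hom B M)

/-- `T` has retractors: every local model of `T` is compatible with some retractor of `T`. (This is
stronger than having at least one retractor.) -/
def HasRetractors (T : Set (NegSentence L)) : Prop :=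
  ∀ M : Struc L, IsLocalModel T M → ∃ C : Struc L, IsRetractor T C ∧ Compatible T M C

end LocalLanguage

/-! Models are handled through diagrams: sets of atomic facts about names, which become a structure
once names declared equal are identified (`sat_toStruc`). A positive formula true in the union of a
chain of diagrams, or in a reduced product, is already true at some stage. So negative sentences
pass to both constructions, and Zorn and compactness arguments are available without ultrafilters,
provided distances stay bounded.

Size of a retractor `C`. A retractor is pc, and by compactness two distinct elements of a pc model
are kept apart by finitely many atomic facts. With variables in place of elements, and with bounds
on the distances of the witnesses from base points, such a list is one of at most `|L|` patterns. If
a sort had more than `2 ^ |L|` elements, Erdős–Rado would give a sequence of type ω all of whose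
increasing pairs realize one pattern. A reduced power of `C` restricted to bounded functions is
again a local model, and in it the sequence stretches along any linear order. Mapping the power back
to `C` preserves the pattern, hence the distinctness, so `C` would contain arbitrarily large sets
(`IsRetractor.exists_injective`).

Equivalence. If there are retractors, every pc model maps to one, injectively by positive
closedness, and inherits the bound. If pc models are bounded in size, their diagrams can be drawn
inside one fixed larger set; a maximal diagram gives a pc model whose homomorphisms to pc models are
all onto, hence isomorphisms. Since every local model maps to a pc one (`exists_hom_isPCModel`),
such a model is a retractor. -/

namespace LocalLanguage

open Filter

variable {L : LocalLanguage.{u}}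

/-! ### Atomic facts, diagrams and the structures they describe -/

/-- Atomic facts about a sorted family of names. -/
inductive Atom (L : LocalLanguage.{u}) (Y : L.Sorts → Type u) : Type u
  | rel {ar : List L.Sorts} (R : L.Rel ar) (t : (i : Fin ar.length) → Y (ar.get i)) : Atom L Y
  | loc {s : L.Sorts} (d : L.Loc s) (x y : Y s) : Atom L Y

namespace Atom

variable {Y Z : L.Sorts → Type u}

/-- An atomic fact holds in a structure under an interpretation of the names. -/
def Holds (N : Struc L) (e : ∀ s, Y s → N.carrier s) : Atom L Y → Prop
  | .rel R t => N.rel R fun i => e _ (t i)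
  | .loc d x y => N.loc d (e _ x) (e _ y)

/-- All names occurring in the atomic fact lie in `D`. -/
def On (D : ∀ s, Set (Y s)) : Atom L Y → Prop
  | .rel _ t => ∀ i, t i ∈ D _
  | .loc _ x y => x ∈ D _ ∧ y ∈ D _

/-- Renaming. -/
def map (g : ∀ s, Y s → Z s) : Atom L Y → Atom L Z
  | .rel R t => .rel R fun i => g _ (t i)
  | .loc d x y => .loc d (g _ x) (g _ y)

theorem holds_map (N : Struc L) (g : ∀ s, Y s → Z s) (e : ∀ s, Z s → N.carrier s)
    (α : Atom L Y) : (α.map g).Holds N e ↔ α.Holds N fun s x => e s (g s x) := by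
  cases α <;> rfl

theorem Holds.hom {M N : Struc L} (f : Struc.Hom M N) {e : ∀ s, Y s → M.carrier s} {α : Atom L Y}
    (h : α.Holds M e) : α.Holds N fun s x => f.toFun s (e s x) := by
  cases α with
  | rel R t => exact f.map_rel R _ h
  | loc d x y => exact f.map_loc d _ _ h

theorem Holds.congr {N : Struc L} {e e' : ∀ s, Y s → N.carrier s} {D : ∀ s, Set (Y s)}
    {α : Atom L Y} (h : α.Holds N e) (hα : α.On D) (hD : ∀ s, ∀ x ∈ D s, e s x = e' s x) :
    α.Holds N e' := by
  cases α with
  | rel R t =>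
    have : (fun i => e' _ (t i)) = fun i => e _ (t i) := funext fun i => (hD _ _ (hα i)).symm
    simpa only [Holds, this] using h
  | loc d x y => simpa only [Holds, hD _ _ hα.1, hD _ _ hα.2] using h

/-- The names occurring in an atomic fact, listed. -/
def names : Atom L Y → List (Σ s, Y s)
  | .rel _ t => List.ofFn fun i => ⟨_, t i⟩
  | .loc _ x y => [⟨_, x⟩, ⟨_, y⟩]

theorem on_names (α : Atom L Y) : α.On fun s => {x | (⟨s, x⟩ : Σ s, Y s) ∈ α.names} := by
  cases α with
  | rel R t => intro i; simp only [names, Set.mem_ofPred_eq, List.mem_ofFn]; exact ⟨i, rfl⟩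
  | loc d x y => simp [On, names]

end Atom

theorem Struc.Sat.of_nil {N : Struc L} {φ : PosFormula L []} {w : N.Env []} (h : N.Sat φ w)
    (w' : N.Env []) : N.Sat φ w' := by
  have : w' = w := by
    funext s x
    cases x
  rwa [this]

section Diagram

variable {Y : L.Sorts → Type u} (cst : ∀ s, L.Const s → Y s)

/-- The value of a term at a tuple of names. -/
def Term.value {Γ : List L.Sorts} (v : ∀ s, Var Γ s → Y s) {s : L.Sorts} : Term L Γ s → Y s
  | .var x => v s x
  | .const c => cst s c

/-- Extension of a tuple of names by one more name. -/
def extend {Γ : List L.Sorts} {s : L.Sorts} (a : Y s) (v : ∀ t, Var Γ t → Y t) :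
    ∀ t, Var (s :: Γ) t → Y t
  | _, .zero => a
  | _, .succ x => v _ x

theorem comp_extend {N : Struc L} (e : ∀ s, Y s → N.carrier s) {Γ : List L.Sorts} {s : L.Sorts}
    (a : Y s) (v : ∀ t, Var Γ t → Y t) :
    (fun t x => e t (extend a v t x)) = Struc.Env.cons (e s a) fun t x => e t (v t x) := by
  funext t x
  cases x <;> rfl

theorem eval_comp {N : Struc L} {e : ∀ s, Y s → N.carrier s}
    (he : ∀ s c, e s (cst s c) = N.const c) {Γ : List L.Sorts} (v : ∀ s, Var Γ s → Y s)
    {s : L.Sorts} (t : Term L Γ s) :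
    N.eval (fun s x => e s (v s x)) t = e s (t.value cst v) := by
  cases t with
  | var x => rfl
  | const c => exact (he s c).symm

/-- Satisfaction of positive formulas in a diagram; a name `x` denotes an element when the diagram
contains `x = x`. -/
def DSat (Δ : Set (Atom L Y)) : {Γ : List L.Sorts} → PosFormula L Γ → (∀ s, Var Γ s → Y s) → Prop
  | _, .rel R t, v => .rel R (fun i => (t i).value cst v) ∈ Δ
  | _, .loc d t₁ t₂, v => .loc d (t₁.value cst v) (t₂.value cst v) ∈ Δ
  | _, .and φ ψ, v => DSat Δ φ v ∧ DSat Δ ψ v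
  | _, .or φ ψ, v => DSat Δ φ v ∨ DSat Δ ψ v
  | _, .ex s φ, v => ∃ a : Y s, .loc 1 a a ∈ Δ ∧ DSat Δ φ (extend a v)

theorem DSat.mono {cst : ∀ s, L.Const s → Y s} {Δ Δ' : Set (Atom L Y)} (h : Δ ⊆ Δ')
    {Γ : List L.Sorts} {φ : PosFormula L Γ} {v : ∀ s, Var Γ s → Y s} :
    DSat cst Δ φ v → DSat cst Δ' φ v := by
  induction φ with
  | rel R t => exact fun hφ => h hφ
  | loc d t₁ t₂ => exact fun hφ => h hφ
  | and φ ψ ih₁ ih₂ => exact And.imp ih₁ ih₂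
  | or φ ψ ih₁ ih₂ => exact Or.imp ih₁ ih₂
  | ex s φ ih => rintro ⟨a, ha, hφ⟩; exact ⟨a, h ha, ih hφ⟩

/-- A positive formula uses only finitely many facts of the diagram, and finitely many facts from a
chain lie in one member. This carries negative sentences to unions of chains. -/
theorem DSat.exists_of_sUnion {cst : ∀ s, L.Const s → Y s} {c : Set (Set (Atom L Y))}
    (hc : IsChain (· ⊆ ·) c) {Γ : List L.Sorts} {φ : PosFormula L Γ} {v : ∀ s, Var Γ s → Y s} :
    DSat cst (⋃₀ c) φ v → ∃ Δ ∈ c, DSat cst Δ φ v := by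
  induction φ with
  | rel R t => rintro ⟨Δ, h, h'⟩; exact ⟨Δ, h, h'⟩
  | loc d t₁ t₂ => rintro ⟨Δ, h, h'⟩; exact ⟨Δ, h, h'⟩
  | and φ ψ ih₁ ih₂ =>
    rintro ⟨h₁, h₂⟩
    obtain ⟨Δ₁, hc₁, h₁⟩ := ih₁ h₁
    obtain ⟨Δ₂, hc₂, h₂⟩ := ih₂ h₂
    obtain h | h := hc.total hc₁ hc₂
    · exact ⟨Δ₂, hc₂, h₁.mono h, h₂⟩
    · exact ⟨Δ₁, hc₁, h₁, h₂.mono h⟩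
  | or φ ψ ih₁ ih₂ =>
    rintro (h | h)
    · obtain ⟨Δ, hΔ, h⟩ := ih₁ h
      exact ⟨Δ, hΔ, .inl h⟩
    · obtain ⟨Δ, hΔ, h⟩ := ih₂ h
      exact ⟨Δ, hΔ, .inr h⟩
  | ex s φ ih =>
    rintro ⟨a, ⟨Δ₁, hc₁, h₁⟩, hφ⟩
    obtain ⟨Δ₂, hc₂, h₂⟩ := ih hφ
    obtain h | h := hc.total hc₁ hc₂
    · exact ⟨Δ₂, hc₂, a, h h₁, h₂⟩
    · exact ⟨Δ₁, hc₁, a, h₁, h₂.mono h⟩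

/-- The diagrams of local models of `T`, possibly with several names for the same element. -/
structure IsModelDiagram (T : Set (NegSentence L)) (Δ : Set (Atom L Y)) : Prop where
  rel_dom : ∀ {ar : List L.Sorts} {R : L.Rel ar} {t : (i : Fin ar.length) → Y (ar.get i)},
    .rel R t ∈ Δ → ∀ i, .loc 1 (t i) (t i) ∈ Δ
  rel_congr : ∀ {ar : List L.Sorts} {R : L.Rel ar} {t t' : (i : Fin ar.length) → Y (ar.get i)},
    .rel R t ∈ Δ → (∀ i, .loc 1 (t i) (t' i) ∈ Δ) → .rel R t' ∈ Δ
  loc_dom : ∀ {s : L.Sorts} {d : L.Loc s} {x y : Y s}, .loc d x y ∈ Δ → .loc 1 x x ∈ Δ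
  symm : ∀ {s : L.Sorts} {d : L.Loc s} {x y : Y s}, .loc d x y ∈ Δ → .loc d y x ∈ Δ
  mono : ∀ {s : L.Sorts} {d₁ d₂ : L.Loc s} {x y : Y s}, d₁ ≤ d₂ → .loc d₁ x y ∈ Δ →
    .loc d₂ x y ∈ Δ
  comp : ∀ {s : L.Sorts} {d₁ d₂ : L.Loc s} {x y z : Y s}, .loc d₁ x y ∈ Δ → .loc d₂ y z ∈ Δ →
    .loc (d₁ * d₂) x z ∈ Δ
  bound : ∀ {s : L.Sorts} (c₁ c₂ : L.Const s), .loc (L.bound c₁ c₂) (cst s c₁) (cst s c₂) ∈ Δ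
  exists_loc : ∀ {s : L.Sorts} {x y : Y s}, .loc 1 x x ∈ Δ → .loc 1 y y ∈ Δ →
    ∃ d, .loc d x y ∈ Δ
  nonempty : ∀ s : L.Sorts, ∃ x : Y s, .loc 1 x x ∈ Δ
  neg : ∀ σ ∈ T, ¬ DSat cst Δ σ.body fun _ x => nomatch x

namespace IsModelDiagram

variable {cst : ∀ s, L.Const s → Y s} {T : Set (NegSentence L)} {Δ : Set (Atom L Y)}

theorem sUnion {c : Set (Set (Atom L Y))} (hc : IsChain (· ⊆ ·) c) (hne : c.Nonempty)
    (h : ∀ Δ ∈ c, IsModelDiagram cst T Δ) : IsModelDiagram cst T (⋃₀ c) where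
  rel_dom := by
    rintro ar R t ⟨Δ, hΔ, ht⟩ i
    exact ⟨Δ, hΔ, (h Δ hΔ).rel_dom ht i⟩
  rel_congr := by
    rintro ar R t t' ht ht'
    have hfin : (insert (Atom.rel R t)
        (Set.range fun i => Atom.loc 1 (t i) (t' i))).Finite := (Set.finite_range _).insert _
    obtain ⟨Δ, hΔ, hsub⟩ := DirectedOn.exists_mem_subset_of_finite_of_subset_sUnion hne
      hc.directedOn hfin (Set.insert_subset ht (Set.range_subset_iff.2 ht'))
    exact ⟨Δ, hΔ, (h Δ hΔ).rel_congr (hsub (Set.mem_insert _ _))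
      fun i => hsub (Set.mem_insert_of_mem _ ⟨i, rfl⟩)⟩
  loc_dom := by
    rintro s d x y ⟨Δ, hΔ, hx⟩
    exact ⟨Δ, hΔ, (h Δ hΔ).loc_dom hx⟩
  symm := by
    rintro s d x y ⟨Δ, hΔ, hx⟩
    exact ⟨Δ, hΔ, (h Δ hΔ).symm hx⟩
  mono := by
    rintro s d₁ d₂ x y hd ⟨Δ, hΔ, hx⟩
    exact ⟨Δ, hΔ, (h Δ hΔ).mono hd hx⟩
  comp := by
    rintro s d₁ d₂ x y z ⟨Δ₁, hc₁, h₁⟩ ⟨Δ₂, hc₂, h₂⟩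
    obtain hs | hs := hc.total hc₁ hc₂
    · exact ⟨Δ₂, hc₂, (h _ hc₂).comp (hs h₁) h₂⟩
    · exact ⟨Δ₁, hc₁, (h _ hc₁).comp h₁ (hs h₂)⟩
  bound := by
    obtain ⟨Δ, hΔ⟩ := hne
    exact fun c₁ c₂ => ⟨Δ, hΔ, (h Δ hΔ).bound c₁ c₂⟩
  exists_loc := by
    rintro s x y ⟨Δ₁, hc₁, h₁⟩ ⟨Δ₂, hc₂, h₂⟩
    obtain hs | hs := hc.total hc₁ hc₂
    · obtain ⟨d, hd⟩ := (h _ hc₂).exists_loc (hs h₁) h₂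
      exact ⟨d, _, hc₂, hd⟩
    · obtain ⟨d, hd⟩ := (h _ hc₁).exists_loc h₁ (hs h₂)
      exact ⟨d, _, hc₁, hd⟩
  nonempty := by
    obtain ⟨Δ, hΔ⟩ := hne
    intro s
    obtain ⟨x, hx⟩ := (h Δ hΔ).nonempty s
    exact ⟨x, Δ, hΔ, hx⟩
  neg := by
    intro σ hσ hs
    obtain ⟨Δ, hΔ, hs⟩ := DSat.exists_of_sUnion hc hs
    exact (h Δ hΔ).neg σ hσ hs

variable (h : IsModelDiagram cst T Δ)

include h in
theorem const_dom {s : L.Sorts} (c : L.Const s) : .loc 1 (cst s c) (cst s c) ∈ Δ :=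
  h.loc_dom (h.bound c c)

/-- Two names are identified when the diagram contains their equality. -/
def setoid (s : L.Sorts) : Setoid {x : Y s // Atom.loc 1 x x ∈ Δ} where
  r x y := .loc 1 x.1 y.1 ∈ Δ
  iseqv := ⟨fun x => x.2, fun hx => h.symm hx, fun hx hy => by simpa using h.comp hx hy⟩

/-- The element denoted by a name. -/
def elem {s : L.Sorts} (x : Y s) (hx : .loc 1 x x ∈ Δ) : Quotient (h.setoid s) :=
  Quotient.mk _ ⟨x, hx⟩

/-- A chosen name of an element. -/
noncomputable def name {s : L.Sorts} (q : Quotient (h.setoid s)) : Y s := q.out.1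

theorem name_dom {s : L.Sorts} (q : Quotient (h.setoid s)) :
    .loc 1 (h.name q) (h.name q) ∈ Δ := q.out.2

theorem elem_name {s : L.Sorts} (q : Quotient (h.setoid s)) :
    h.elem (h.name q) (h.name_dom q) = q := Quotient.out_eq q

theorem elem_eq {s : L.Sorts} {x y : Y s} {hx : .loc 1 x x ∈ Δ} {hy : .loc 1 y y ∈ Δ} :
    h.elem x hx = h.elem y hy ↔ .loc 1 x y ∈ Δ :=
  Quotient.eq (r := h.setoid s)

theorem name_elem {s : L.Sorts} (x : Y s) (hx : .loc 1 x x ∈ Δ) :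
    .loc 1 (h.name (h.elem x hx)) x ∈ Δ :=
  h.elem_eq.1 (h.elem_name (h.elem x hx))

/-- The structure described by a diagram. -/
noncomputable def toStruc : Struc L where
  carrier s := Quotient (h.setoid s)
  nonempty_carrier s := let ⟨x, hx⟩ := h.nonempty s; ⟨h.elem x hx⟩
  const c := h.elem (cst _ c) (h.const_dom c)
  rel R t := .rel R (fun i => h.name (t i)) ∈ Δ
  loc d x y := .loc d (h.name x) (h.name y) ∈ Δ
  loc_one x y := by
    rw [← h.elem_eq (hx := h.name_dom x) (hy := h.name_dom y), h.elem_name, h.elem_name]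

theorem rel_elem {ar : List L.Sorts} (R : L.Rel ar) (t : (i : Fin ar.length) → Y (ar.get i))
    (ht : ∀ i, .loc 1 (t i) (t i) ∈ Δ) :
    h.toStruc.rel R (fun i => h.elem (t i) (ht i)) ↔ .rel R t ∈ Δ :=
  ⟨fun hr => h.rel_congr hr fun i => h.name_elem _ (ht i),
    fun hr => h.rel_congr hr fun i => h.symm (h.name_elem _ (ht i))⟩

theorem loc_elem {s : L.Sorts} (d : L.Loc s) {x y : Y s} (hx : .loc 1 x x ∈ Δ)
    (hy : .loc 1 y y ∈ Δ) : h.toStruc.loc d (h.elem x hx) (h.elem y hy) ↔ .loc d x y ∈ Δ := by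
  constructor <;> intro hd
  · simpa using h.comp (h.comp (h.symm (h.name_elem x hx)) hd) (h.name_elem y hy)
  · have := h.comp (h.comp (h.name_elem x hx) hd) (h.symm (h.name_elem y hy))
    rwa [one_mul, mul_one] at this

theorem sat_toStruc {Γ : List L.Sorts} (φ : PosFormula L Γ) (v : ∀ s, Var Γ s → Y s)
    (hv : ∀ s x, .loc 1 (v s x) (v s x) ∈ Δ) :
    h.toStruc.Sat φ (fun s x => h.elem (v s x) (hv s x)) ↔ DSat cst Δ φ v := by
  have hterm : ∀ {Γ : List L.Sorts} (v : ∀ s, Var Γ s → Y s)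
      (hv : ∀ s x, .loc 1 (v s x) (v s x) ∈ Δ) {s : L.Sorts} (t : Term L Γ s),
      ∃ ht : .loc 1 (t.value cst v) (t.value cst v) ∈ Δ,
        h.toStruc.eval (fun s x => h.elem (v s x) (hv s x)) t = h.elem (t.value cst v) ht := by
    intro Γ v hv s t
    cases t with
    | var x => exact ⟨hv s x, rfl⟩
    | const c => exact ⟨h.const_dom c, rfl⟩
  induction φ with
  | rel R t =>
    choose ht ht' using fun i => hterm v hv (t i)
    simp only [Struc.Sat, DSat, ht']
    exact h.rel_elem R _ ht
  | loc d t₁ t₂ =>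
    obtain ⟨h₁, h₁'⟩ := hterm v hv t₁
    obtain ⟨h₂, h₂'⟩ := hterm v hv t₂
    simp only [Struc.Sat, DSat, h₁', h₂']
    exact h.loc_elem d h₁ h₂
  | and φ ψ ih₁ ih₂ => exact and_congr (ih₁ v hv) (ih₂ v hv)
  | or φ ψ ih₁ ih₂ => exact or_congr (ih₁ v hv) (ih₂ v hv)
  | ex s φ ih =>
    have hcons : ∀ (a : Y s) (ha : .loc 1 a a ∈ Δ),
        ∃ hv' : ∀ t x, .loc 1 (extend a v t x) (extend a v t x) ∈ Δ,
          (Struc.Env.cons (M := h.toStruc) (h.elem a ha) fun s x => h.elem (v s x) (hv s x)) =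
            fun t x => h.elem (extend a v t x) (hv' t x) := by
      intro a ha
      refine ⟨fun t x => ?_, ?_⟩
      · cases x with
        | zero => exact ha
        | succ x => exact hv _ x
      · funext t x
        cases x <;> rfl
    constructor
    · rintro ⟨q, hq⟩
      obtain ⟨hv', he⟩ := hcons (h.name q) (h.name_dom q)
      rw [← h.elem_name q, he] at hq
      exact ⟨h.name q, h.name_dom q, (ih _ hv').1 hq⟩
    · rintro ⟨a, ha, hφ⟩
      obtain ⟨hv', he⟩ := hcons a ha
      refine ⟨h.elem a ha, ?_⟩
      rw [he]
      exact (ih _ hv').2 hφ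

theorem isLocalModel_toStruc : IsLocalModel T h.toStruc := by
  refine ⟨⟨fun d a b => h.symm, fun d₁ d₂ hd a b => h.mono hd, fun d₁ d₂ a b c => h.comp,
    fun c₁ c₂ => (h.loc_elem _ _ _).2 (h.bound c₁ c₂),
    fun a b => h.exists_loc (h.name_dom a) (h.name_dom b)⟩, fun σ hσ hs => h.neg σ hσ ?_⟩
  exact (h.sat_toStruc σ.body _ (fun _ x => nomatch x)).1 (hs.of_nil _)

/-- A homomorphism from the structure of a diagram, as an interpretation of all names. -/
theorem exists_interpretation {N : Struc L} (f : Struc.Hom h.toStruc N) :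
    ∃ e : ∀ s, Y s → N.carrier s, (∀ s c, e s (cst s c) = N.const c) ∧
      (∀ α ∈ Δ, α.Holds N e) ∧ ∀ s x hx, e s x = f.toFun s (h.elem x hx) := by
  classical
  have := N.nonempty_carrier
  -- Names that denote nothing get an arbitrary value; no fact of `Δ` mentions them.
  let e : ∀ s, Y s → N.carrier s := fun s x =>
    if hx : .loc 1 x x ∈ Δ then f.toFun s (h.elem x hx) else Classical.arbitrary _
  have he : ∀ s x hx, e s x = f.toFun s (h.elem x hx) := fun s x hx => dif_pos hx
  refine ⟨e, fun s c => (he s _ (h.const_dom c)).trans (f.map_const c), ?_, he⟩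
  rintro (⟨R, t⟩ | ⟨d, x, y⟩) hα
  · have ht := h.rel_dom hα
    have := f.map_rel R _ ((h.rel_elem R t ht).2 hα)
    simpa only [Atom.Holds, he _ _ (ht _)] using this
  · have hx := h.loc_dom hα
    have hy := h.loc_dom (h.symm hα)
    have := f.map_loc d _ _ ((h.loc_elem d hx hy).2 hα)
    simpa only [Atom.Holds, he _ _ hx, he _ _ hy] using this

end IsModelDiagram

/-- Positive closedness of a diagram. -/
def IsPCDiagram (T : Set (NegSentence L)) (Δ : Set (Atom L Y)) : Prop :=
  ∀ N : Struc L, IsLocalModel T N → ∀ e : ∀ s, Y s → N.carrier s,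
    (∀ s c, e s (cst s c) = N.const c) → (∀ α ∈ Δ, α.Holds N e) →
      ∀ (Γ : List L.Sorts) (φ : PosFormula L Γ) (v : ∀ s, Var Γ s → Y s),
        (∀ s x, .loc 1 (v s x) (v s x) ∈ Δ) → N.Sat φ (fun s x => e s (v s x)) → DSat cst Δ φ v

theorem IsPCDiagram.isPCModel {cst : ∀ s, L.Const s → Y s} {T : Set (NegSentence L)}
    {Δ : Set (Atom L Y)} (hΔ : IsPCDiagram cst T Δ) (h : IsModelDiagram cst T Δ) :
    IsPCModel T h.toStruc := by
  refine ⟨h.isLocalModel_toStruc, fun N hN f Γ φ v hφ => ?_⟩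
  obtain ⟨e, hc, he, hf⟩ := h.exists_interpretation f
  have hv : v = fun s x => h.elem (h.name (v s x)) (h.name_dom _) := by
    funext s x
    exact (h.elem_name _).symm
  rw [hv]
  refine (h.sat_toStruc φ _ _).2 (hΔ N hN e hc he Γ φ _ (fun s x => h.name_dom _) ?_)
  have hw : (fun s x => e s (h.name (v s x))) = f.mapEnv v := by
    funext s x
    exact (hf _ _ (h.name_dom _)).trans (congrArg (f.toFun s) (h.elem_name _))
  exact hw ▸ hφ

/-! ### Reduced products and pullbacks -/

section Reduced

variable {I : Type*} (F : Filter I) (N : I → Struc L) (e : ∀ i s, Y s → (N i).carrier s)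
  (D : ∀ s, Set (Y s))

/-- The atomic facts about the names in `D` that hold in a family of structures, modulo a
filter. -/
def reducedDiagram : Set (Atom L Y) := {α | α.On D ∧ ∀ᶠ i in F, α.Holds (N i) (e i)}

variable {F N e D}

theorem loc_one_mem_reducedDiagram {s : L.Sorts} {x : Y s} :
    .loc 1 x x ∈ reducedDiagram F N e D ↔ x ∈ D s :=
  ⟨fun h => h.1.1, fun h => ⟨⟨h, h⟩, Eventually.of_forall fun i => ((N i).loc_one _ _).2 rfl⟩⟩

variable {cst : ∀ s, L.Const s → Y s}

/-- The half of Łoś's theorem that needs no ultrafilter; the converse can fail at disjunctions, but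
this half is what preserves negative sentences. -/
theorem DSat.eventually_sat (hc : ∀ i s c, e i s (cst s c) = (N i).const c)
    {Γ : List L.Sorts} {φ : PosFormula L Γ} {v : ∀ s, Var Γ s → Y s} :
    DSat cst (reducedDiagram F N e D) φ v → ∀ᶠ i in F, (N i).Sat φ fun s x => e i s (v s x) := by
  induction φ with
  | rel R t =>
    rintro ⟨-, h⟩
    filter_upwards [h] with i hi
    simpa only [Struc.Sat, Atom.Holds, eval_comp cst (hc i)] using hi
  | loc d t₁ t₂ =>
    rintro ⟨-, h⟩
    filter_upwards [h] with i hi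
    simpa only [Struc.Sat, Atom.Holds, eval_comp cst (hc i)] using hi
  | and φ ψ ih₁ ih₂ => exact fun h => (ih₁ h.1).and (ih₂ h.2)
  | or φ ψ ih₁ ih₂ =>
    rintro (h | h)
    · exact (ih₁ h).mono fun i => Or.inl
    · exact (ih₂ h).mono fun i => Or.inr
  | ex s φ ih =>
    rintro ⟨a, -, h⟩
    filter_upwards [ih h] with i hi
    rw [comp_extend] at hi
    exact ⟨_, hi⟩

/-- The hypothesis `hloc` is the only obstacle: two families may drift apart without any single
locality relation holding along the filter, so (A5) has to be ensured by the choice of names. -/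
theorem isModelDiagram_reducedDiagram [F.NeBot] {T : Set (NegSentence L)}
    (hN : ∀ i, IsLocalModel T (N i)) (hc : ∀ i s c, e i s (cst s c) = (N i).const c)
    (hD : ∀ s, (D s).Nonempty) (hcD : ∀ s c, cst s c ∈ D s)
    (hloc : ∀ s, ∀ x ∈ D s, ∀ y ∈ D s, ∃ d, ∀ᶠ i in F, (N i).loc d (e i s x) (e i s y)) :
    IsModelDiagram cst T (reducedDiagram F N e D) where
  rel_dom h i := loc_one_mem_reducedDiagram.2 (h.1 i)
  rel_congr := by
    intro ar R t t' h h'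
    refine ⟨fun i => (h' i).1.2, ?_⟩
    filter_upwards [h.2, eventually_all.2 fun i => (h' i).2] with i hi hi'
    have : (fun j => e i _ (t' j)) = fun j => e i _ (t j) :=
      funext fun j => (((N i).loc_one _ _).1 (hi' j)).symm
    simpa only [Atom.Holds, this] using hi
  loc_dom h := loc_one_mem_reducedDiagram.2 h.1.1
  symm h := ⟨h.1.symm, h.2.mono fun i => (hN i).1.symm _ _ _⟩
  mono hd h := ⟨h.1, h.2.mono fun i => (hN i).1.mono _ _ hd _ _⟩
  comp h₁ h₂ := ⟨⟨h₁.1.1, h₂.1.2⟩, by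
    filter_upwards [h₁.2, h₂.2] with i hi hi'
    exact (hN i).1.comp _ _ _ _ _ hi hi'⟩
  bound c₁ c₂ := ⟨⟨hcD _ _, hcD _ _⟩, Eventually.of_forall fun i => by
    simpa only [Atom.Holds, hc] using (hN i).1.bound c₁ c₂⟩
  exists_loc h₁ h₂ := by
    have hx := loc_one_mem_reducedDiagram.1 h₁
    have hy := loc_one_mem_reducedDiagram.1 h₂
    obtain ⟨d, hd⟩ := hloc _ _ hx _ hy
    exact ⟨d, ⟨hx, hy⟩, hd⟩
  nonempty s := by
    obtain ⟨x, hx⟩ := hD s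
    exact ⟨x, loc_one_mem_reducedDiagram.2 hx⟩
  neg σ hσ h := by
    obtain ⟨i, hi⟩ := (DSat.eventually_sat hc h).exists
    exact (hN i).2 σ hσ (hi.of_nil _)

end Reduced

section Pullback

/-- The atomic facts about the names in `D` that hold in a structure. -/
def pullback (N : Struc L) (e : ∀ s, Y s → N.carrier s) (D : ∀ s, Set (Y s)) : Set (Atom L Y) :=
  reducedDiagram (pure ()) (fun _ : Unit => N) (fun _ => e) D

variable {N : Struc L} {e : ∀ s, Y s → N.carrier s} {D : ∀ s, Set (Y s)}
  {cst : ∀ s, L.Const s → Y s} {T : Set (NegSentence L)}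

theorem mem_pullback {α : Atom L Y} : α ∈ pullback N e D ↔ α.On D ∧ α.Holds N e := by
  simp [pullback, reducedDiagram]

theorem loc_one_mem_pullback {s : L.Sorts} {x : Y s} :
    .loc 1 x x ∈ pullback N e D ↔ x ∈ D s :=
  loc_one_mem_reducedDiagram

theorem isModelDiagram_pullback (hN : IsLocalModel T N)
    (hc : ∀ s c, e s (cst s c) = N.const c) (hD : ∀ s, (D s).Nonempty)
    (hcD : ∀ s c, cst s c ∈ D s) : IsModelDiagram cst T (pullback N e D) :=
  isModelDiagram_reducedDiagram (fun _ => hN) (fun _ => hc) hD hcD fun s x _ y _ =>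
    let ⟨d, hd⟩ := hN.1.exists_loc (e s x) (e s y)
    ⟨d, Eventually.of_forall fun _ => hd⟩

theorem subset_pullback {Δ : Set (Atom L Y)} (h : IsModelDiagram cst T Δ)
    (hD : ∀ s x, .loc 1 x x ∈ Δ → x ∈ D s) (he : ∀ α ∈ Δ, α.Holds N e) :
    Δ ⊆ pullback N e D := by
  rintro (⟨R, t⟩ | ⟨d, x, y⟩) hα
  · exact mem_pullback.2 ⟨fun i => hD _ _ (h.rel_dom hα i), he _ hα⟩
  · exact mem_pullback.2 ⟨⟨hD _ _ (h.loc_dom hα), hD _ _ (h.loc_dom (h.symm hα))⟩, he _ hα⟩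

end Pullback

end Diagram

/-- A positive formula true in `N` is true of any family of names that covers a suitable finite set
of witnesses. -/
theorem exists_finset_dsat {N : Struc L} {Γ : List L.Sorts} {φ : PosFormula L Γ} {w : N.Env Γ}
    (h : N.Sat φ w) : ∃ S : Set (Σ s, N.carrier s), S.Finite ∧
      ∀ (Y : L.Sorts → Type u) (cst : ∀ s, L.Const s → Y s) (e : ∀ s, Y s → N.carrier s)
        (D : ∀ s, Set (Y s)) (v : ∀ s, Var Γ s → Y s), (∀ s c, e s (cst s c) = N.const c) →
        (∀ s c, cst s c ∈ D s) → (∀ p ∈ S, ∃ x ∈ D p.1, e _ x = p.2) → (∀ s x, v s x ∈ D s) →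
        (∀ s x, e s (v s x) = w s x) → DSat cst (pullback N e D) φ v := by
  have hterm : ∀ {Y : L.Sorts → Type u} {cst : ∀ s, L.Const s → Y s}
      {e : ∀ s, Y s → N.carrier s} {D : ∀ s, Set (Y s)} {Γ : List L.Sorts} {w : N.Env Γ}
      {v : ∀ s, Var Γ s → Y s}, (∀ s c, e s (cst s c) = N.const c) →
      (∀ s c, cst s c ∈ D s) → (∀ s x, v s x ∈ D s) → (∀ s x, e s (v s x) = w s x) →
      ∀ {s : L.Sorts} (t : Term L Γ s), t.value cst v ∈ D s ∧ e s (t.value cst v) = N.eval w t := by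
    intro Y cst e D Γ w v hc hcD hv hw s t
    cases t with
    | var x => exact ⟨hv s x, hw s x⟩
    | const c => exact ⟨hcD s c, hc s c⟩
  induction φ with
  | rel R t =>
    refine ⟨∅, Set.finite_empty, fun Y cst e D v hc hcD _ hv hw => mem_pullback.2 ?_⟩
    have ht := fun i => hterm hc hcD hv hw (t i)
    refine ⟨fun i => (ht i).1, ?_⟩
    simpa only [Struc.Sat, Atom.Holds, (ht _).2] using h
  | loc d t₁ t₂ =>
    refine ⟨∅, Set.finite_empty, fun Y cst e D v hc hcD _ hv hw => mem_pullback.2 ?_⟩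
    have h₁ := hterm hc hcD hv hw t₁
    have h₂ := hterm hc hcD hv hw t₂
    refine ⟨⟨h₁.1, h₂.1⟩, ?_⟩
    simpa only [Struc.Sat, Atom.Holds, h₁.2, h₂.2] using h
  | and φ ψ ih₁ ih₂ =>
    obtain ⟨S₁, hS₁, h₁⟩ := ih₁ h.1
    obtain ⟨S₂, hS₂, h₂⟩ := ih₂ h.2
    exact ⟨S₁ ∪ S₂, hS₁.union hS₂, fun Y cst e D v hc hcD hS hv hw =>
      ⟨h₁ Y cst e D v hc hcD (fun p hp => hS p (.inl hp)) hv hw,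
        h₂ Y cst e D v hc hcD (fun p hp => hS p (.inr hp)) hv hw⟩⟩
  | or φ ψ ih₁ ih₂ =>
    obtain h | h := h
    · obtain ⟨S, hS, h⟩ := ih₁ h
      exact ⟨S, hS, fun Y cst e D v hc hcD hS hv hw => .inl (h Y cst e D v hc hcD hS hv hw)⟩
    · obtain ⟨S, hS, h⟩ := ih₂ h
      exact ⟨S, hS, fun Y cst e D v hc hcD hS hv hw => .inr (h Y cst e D v hc hcD hS hv hw)⟩
  | ex s φ ih =>
    obtain ⟨a, ha⟩ := h
    obtain ⟨S, hS, h⟩ := ih ha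
    refine ⟨insert ⟨s, a⟩ S, hS.insert _, fun Y cst e D v hc hcD hS hv hw => ?_⟩
    obtain ⟨x, hx, hxa⟩ := hS ⟨s, a⟩ (Set.mem_insert _ _)
    refine ⟨x, loc_one_mem_pullback.2 hx, h Y cst e D _ hc hcD
      (fun p hp => hS p (Set.mem_insert_of_mem _ hp)) ?_ ?_⟩
    · intro t y
      cases y with
      | zero => exact hx
      | succ y => exact hv _ y
    · intro t y
      cases y with
      | zero => exact hxa
      | succ y => exact hw _ y

/-! ### Mapping local models to positively closed ones -/

/-- Names for the elements of a positively closed extension of `M`: each formula with named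
parameters comes with infinitely many names, of every sort, for its witnesses. -/
inductive Name (M : Struc L) : L.Sorts → Type u
  | base {s : L.Sorts} (a : M.carrier s) : Name M s
  | wit {s : L.Sorts} {Γ : List L.Sorts} (φ : PosFormula L Γ) (v : ∀ t, Var Γ t → Name M t)
      (n : ℕ) : Name M s

/-- The element denoted by a base name. -/
noncomputable def Name.toBase {M : Struc L} : ∀ s, Name M s → M.carrier s
  | _, .base a => a
  | s, .wit _ _ _ => (M.nonempty_carrier s).some

/-- Composition of homomorphisms. -/
def Struc.Hom.comp {M N P : Struc L} (g : Struc.Hom N P) (f : Struc.Hom M N) : Struc.Hom M P where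
  toFun s a := g.toFun s (f.toFun s a)
  map_const c := by rw [f.map_const, g.map_const]
  map_rel R a h := g.map_rel R _ (f.map_rel R a h)
  map_loc d a b h := g.map_loc d _ _ (f.map_loc d a b h)

theorem IsModelDiagram.on_dom {Y : L.Sorts → Type u} {cst : ∀ s, L.Const s → Y s}
    {T : Set (NegSentence L)} {Δ : Set (Atom L Y)} (h : IsModelDiagram cst T Δ) {α : Atom L Y}
    (hα : α ∈ Δ) : α.On fun _ => {x | .loc 1 x x ∈ Δ} := by
  cases α with
  | rel R t => exact h.rel_dom hα
  | loc d x y => exact ⟨h.loc_dom hα, h.loc_dom (h.symm hα)⟩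

theorem Var.finite_sigma {S : Type u} (Γ : List S) : Finite (Σ s, Var Γ s) := by
  induction Γ with
  | nil => exact @Finite.of_subsingleton _ ⟨fun x => nomatch x.2⟩
  | cons t Γ ih =>
    refine Finite.of_surjective (fun o : Option (Σ s, Var Γ s) =>
      o.elim (⟨t, .zero⟩ : Σ s, Var (t :: Γ) s) fun x => ⟨x.1, .succ x.2⟩) ?_
    rintro ⟨s, _ | x⟩
    · exact ⟨none, rfl⟩
    · exact ⟨some ⟨s, x⟩, rfl⟩

/-- A tuple has finitely many entries, so it is named in one member of the chain, and an
interpretation of the union also interprets that member. -/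
theorem IsPCDiagram.sUnion {Y : L.Sorts → Type u} {cst : ∀ s, L.Const s → Y s}
    {T : Set (NegSentence L)} {c : Set (Set (Atom L Y))} (hc : IsChain (· ⊆ ·) c)
    (hne : c.Nonempty) (h : ∀ Δ ∈ c, IsPCDiagram cst T Δ) : IsPCDiagram cst T (⋃₀ c) := by
  intro N hN e hce he Γ φ v hv hφ
  have := Var.finite_sigma Γ
  obtain ⟨Δ, hΔ, hsub⟩ := DirectedOn.exists_mem_subset_of_finite_of_subset_sUnion hne
    hc.directedOn (Set.finite_range fun x : Σ s, Var Γ s => Atom.loc 1 (v _ x.2) (v _ x.2))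
    (Set.range_subset_iff.2 fun x => hv _ _)
  exact (h Δ hΔ N hN e hce (fun α hα => he α ⟨Δ, hΔ, hα⟩) Γ φ v (fun s x => hsub ⟨⟨s, x⟩, rfl⟩)
    hφ).mono (Set.subset_sUnion_of_mem hΔ)

/-- Lets the names `wit φ v n` reach any finite set of witnesses, whatever its size and sorts. -/
theorem exists_seq_covering {S : L.Sorts → Type u} [∀ s, Nonempty (S s)]
    {F : Set (Σ s, S s)} (hF : F.Finite) : ∃ h : ∀ s, ℕ → S s, ∀ p ∈ F, ∃ n, h p.1 n = p.2 := by
  have : ∀ s, ∃ h : ℕ → S s, ∀ a, (⟨s, a⟩ : Σ s, S s) ∈ F → ∃ n, h n = a := by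
    intro s
    have hc : (Sigma.mk s ⁻¹' F).Countable :=
      hF.countable.preimage_of_injOn sigma_mk_injective.injOn
    obtain ⟨h, hh⟩ := Set.Countable.exists_eq_range (hc.insert (Classical.arbitrary (S s)))
      (Set.insert_nonempty _ _)
    refine ⟨h, fun a ha => ?_⟩
    have : a ∈ Set.range h := hh ▸ Set.mem_insert_of_mem _ ha
    exact this
  choose h hh using this
  exact ⟨h, fun p hp => hh p.1 p.2 hp⟩

/-- Every local model maps to a positively closed one. -/
theorem exists_hom_isPCModel {T : Set (NegSentence L)} {M : Struc L} (hM : IsLocalModel T M) :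
    ∃ P : Struc L, IsPCModel T P ∧ Nonempty (Struc.Hom M P) := by
  classical
  let cst : ∀ s, L.Const s → Name M s := fun s c => .base (M.const c)
  let Δ₀ : Set (Atom L (Name M)) := pullback M Name.toBase fun s => Set.range Name.base
  have hΔ₀ : IsModelDiagram cst T Δ₀ :=
    isModelDiagram_pullback hM (fun s c => rfl)
      (fun s => have := M.nonempty_carrier s; Set.range_nonempty _) fun s c => ⟨_, rfl⟩
  -- The second clause reserves the names `wit φ v n`: they may be used only once `φ` holds at `v`.
  let P : Set (Set (Atom L (Name M))) := {Δ | IsModelDiagram cst T Δ ∧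
    ∀ s Γ (φ : PosFormula L Γ) v n,
      .loc 1 (Name.wit (s := s) φ v n) (Name.wit φ v n) ∈ Δ → DSat cst Δ φ v}
  have hP₀ : Δ₀ ∈ P := by
    refine ⟨hΔ₀, fun s Γ φ v n h => ?_⟩
    obtain ⟨a, ha⟩ := loc_one_mem_pullback.1 h
    cases ha
  obtain ⟨Δ, hΔ₀Δ, hΔ⟩ := zorn_subset_nonempty P (fun c hc hchain hne =>
    ⟨⋃₀ c, ⟨IsModelDiagram.sUnion hchain hne fun Δ h => (hc h).1, by
      rintro s Γ φ v n ⟨Δ, hΔ, hn⟩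
      exact ((hc hΔ).2 s Γ φ v n hn).mono (Set.subset_sUnion_of_mem hΔ)⟩,
      fun Δ h => Set.subset_sUnion_of_mem h⟩) Δ₀ hP₀
  have h := hΔ.prop.1
  refine ⟨h.toStruc, IsPCDiagram.isPCModel (fun N hN e hc he Γ φ v hv hφ => ?_) h, ⟨?_⟩⟩
  · by_contra hns
    -- As `φ` fails at `v` in `Δ`, its witness names are all free. They are reinterpreted as
    -- witnesses in `N`, and the pullback of `N` is then a member of `P` above `Δ` in which `φ`
    -- holds at `v`, against maximality.
    have hfresh : ∀ s n, .loc 1 (Name.wit (s := s) φ v n) (Name.wit φ v n) ∉ Δ :=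
      fun s n hn => hns (hΔ.prop.2 s Γ φ v n hn)
    obtain ⟨F, hF, hFφ⟩ := exists_finset_dsat hφ
    have := N.nonempty_carrier
    obtain ⟨w, hw⟩ := exists_seq_covering hF
    let e' : ∀ s, Name M s → N.carrier s := fun s x =>
      if hx : ∃ n, x = .wit φ v n then w s hx.choose else e s x
    have he' : ∀ s x, .loc 1 x x ∈ Δ → e' s x = e s x := by
      refine fun s x hx => dif_neg ?_
      rintro ⟨n, rfl⟩
      exact hfresh s n hx
    have hew : ∀ s n, e' s (.wit φ v n) = w s n := by
      intro s n
      have hx : ∃ m, (Name.wit φ v n : Name M s) = .wit φ v m := ⟨n, rfl⟩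
      have hn : n = hx.choose := by
        have := hx.choose_spec
        injection this
      exact (dif_pos hx).trans (congrArg (w s) hn.symm)
    let D : ∀ s, Set (Name M s) := fun s => {x | .loc 1 x x ∈ Δ ∨ ∃ n, x = .wit φ v n}
    have hc' : ∀ s c, e' s (cst s c) = N.const c := fun s c =>
      (he' s _ (h.const_dom c)).trans (hc s c)
    have hcD : ∀ s c, cst s c ∈ D s := fun s c => .inl (h.const_dom c)
    have hsub : Δ ⊆ pullback N e' D := by
      refine subset_pullback h (fun s x hx => .inl hx) fun α hα => ?_
      exact (he α hα).congr (h.on_dom hα) fun s x hx => (he' s x hx).symm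
    have hD : DSat cst (pullback N e' D) φ v :=
      hFφ _ cst e' D v hc' hcD
        (fun p hp => let ⟨n, hn⟩ := hw p hp; ⟨.wit φ v n, .inr ⟨n, rfl⟩, (hew _ n).trans hn⟩)
        (fun s x => .inl (hv s x)) (fun s x => he' s _ (hv s x))
    have hmem : pullback N e' D ∈ P := by
      refine ⟨isModelDiagram_pullback hN hc'
        (fun s => let ⟨x, hx⟩ := h.nonempty s; ⟨x, .inl hx⟩) hcD, fun s Γ' ψ u n hn => ?_⟩
      obtain hn | ⟨m, hm⟩ := loc_one_mem_pullback.1 hn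
      · exact (hΔ.prop.2 s Γ' ψ u n hn).mono hsub
      · cases hm
        exact hD
    exact hns ((hΔ.eq_of_subset hmem hsub) ▸ hD)
  · have hdom : ∀ {s} (a : M.carrier s), .loc 1 (Name.base a) (Name.base a) ∈ Δ := fun a =>
      hΔ₀Δ (loc_one_mem_pullback.2 ⟨a, rfl⟩)
    exact
      { toFun := fun s a => h.elem (.base a) (hdom a)
        map_const := fun c => rfl
        map_rel := fun R t ht => (h.rel_elem R _ fun i => hdom (t i)).2
          (hΔ₀Δ (mem_pullback.2 ⟨fun i => ⟨_, rfl⟩, ht⟩))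
        map_loc := fun d a b hd => (h.loc_elem d (hdom a) (hdom b)).2
          (hΔ₀Δ (mem_pullback.2 ⟨⟨⟨_, rfl⟩, ⟨_, rfl⟩⟩, hd⟩)) }

/-! ### Positive embeddings -/

theorem Struc.Hom.IsPosEmbedding.loc_iff {M N : Struc L} {f : Struc.Hom M N}
    (hf : f.IsPosEmbedding) {s : L.Sorts} (d : L.Loc s) (a b : M.carrier s) :
    N.loc d (f.toFun s a) (f.toFun s b) ↔ M.loc d a b :=
  ⟨fun h => hf [s, s] (.loc d (.var .zero) (.var (.succ .zero)))
    (Struc.Env.cons a (Struc.Env.cons b (Struc.Env.nil M))) h, f.map_loc d a b⟩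

theorem Struc.Hom.IsPosEmbedding.injective {M N : Struc L} {f : Struc.Hom M N}
    (hf : f.IsPosEmbedding) (s : L.Sorts) : Function.Injective (f.toFun s) := fun a b h =>
  (M.loc_one a b).1 ((hf.loc_iff 1 a b).1 ((N.loc_one _ _).2 h))

/-- The variables of a finite context of sorts, with the `i`-th one of sort `l.get i`. -/
def Var.ofFin {S : Type u} : (l : List S) → (i : Fin l.length) → Var l (l.get i)
  | _ :: _, ⟨0, _⟩ => .zero
  | _ :: l, ⟨i + 1, h⟩ => .succ (Var.ofFin l ⟨i, Nat.lt_of_succ_lt_succ h⟩)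

/-- The tuple with the given entries. -/
def Struc.envOfFin (M : Struc L) :
    (l : List L.Sorts) → ((i : Fin l.length) → M.carrier (l.get i)) → M.Env l
  | [], _ => Struc.Env.nil M
  | _ :: l, t => Struc.Env.cons (t ⟨0, Nat.succ_pos _⟩)
      (M.envOfFin l fun i => t ⟨i + 1, Nat.succ_lt_succ i.2⟩)

theorem Struc.envOfFin_ofFin (M : Struc L) : (l : List L.Sorts) →
    (t : (i : Fin l.length) → M.carrier (l.get i)) → (i : Fin l.length) →
    M.envOfFin l t _ (Var.ofFin l i) = t i
  | _ :: _, _, ⟨0, _⟩ => rfl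
  | _ :: l, t, ⟨i + 1, h⟩ =>
    M.envOfFin_ofFin l (fun i => t ⟨i + 1, Nat.succ_lt_succ i.2⟩) ⟨i, Nat.lt_of_succ_lt_succ h⟩

theorem Struc.Hom.IsPosEmbedding.rel_iff {M N : Struc L} {f : Struc.Hom M N}
    (hf : f.IsPosEmbedding) {ar : List L.Sorts} (R : L.Rel ar)
    (t : (i : Fin ar.length) → M.carrier (ar.get i)) :
    N.rel R (fun i => f.toFun _ (t i)) ↔ M.rel R t := by
  refine ⟨fun h => ?_, f.map_rel R t⟩
  have := hf ar (.rel R fun i => .var (Var.ofFin ar i)) (M.envOfFin ar t)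
  simp only [Struc.Sat, Struc.eval, Struc.Hom.mapEnv, M.envOfFin_ofFin ar t] at this
  exact this h

/-- A surjective positive embedding is an isomorphism. -/
theorem Struc.Hom.IsPosEmbedding.exists_inverse {M N : Struc L} {f : Struc.Hom M N}
    (hf : f.IsPosEmbedding) (hs : ∀ s, Function.Surjective (f.toFun s)) :
    ∃ g : Struc.Hom N M, g.IsRetraction f := by
  choose g hg using hs
  refine ⟨⟨g, fun {s} c => hf.injective s ((hg s _).trans (f.map_const c).symm), ?_, ?_⟩,
    fun s a => hf.injective s (hg s _)⟩
  · intro ar R a ha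
    rw [← hf.rel_iff]
    simpa only [hg] using ha
  · intro s d a b ha
    rw [← hf.loc_iff]
    simpa only [hg] using ha

/-- The diagram of a positively closed model under a surjective naming is positively closed. -/
theorem IsPCModel.isPCDiagram_pullback {Y : L.Sorts → Type u} {cst : ∀ s, L.Const s → Y s}
    {T : Set (NegSentence L)} {N : Struc L} (hN : IsPCModel T N) {e : ∀ s, Y s → N.carrier s}
    {D : ∀ s, Set (Y s)} (hc : ∀ s c, e s (cst s c) = N.const c) (hcD : ∀ s c, cst s c ∈ D s)
    (hs : ∀ s a, ∃ x ∈ D s, e s x = a) : IsPCDiagram cst T (pullback N e D) := by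
  intro N' hN' e' hc' he' Γ φ v hv hφ
  choose g hgD hg using hs
  have hge : ∀ s, ∀ x ∈ D s, e' s (g s (e s x)) = e' s x := by
    intro s x hx
    have : Atom.loc 1 (g s (e s x)) x ∈ pullback N e D :=
      mem_pullback.2 ⟨⟨hgD _ _, hx⟩, (N.loc_one _ _).2 (hg s _)⟩
    exact (N'.loc_one _ _).1 (he' _ this)
  let f : Struc.Hom N N' :=
    { toFun := fun s a => e' s (g s a)
      map_const := fun {s} c => by rw [← hc, hge s _ (hcD s c), hc']
      map_rel := fun R a ha => he' (.rel R fun i => g _ (a i))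
        (mem_pullback.2 ⟨fun i => hgD _ _, by simpa only [Atom.Holds, hg] using ha⟩)
      map_loc := fun d a b ha => he' (.loc d (g _ a) (g _ b))
        (mem_pullback.2 ⟨⟨hgD _ _, hgD _ _⟩, by simpa only [Atom.Holds, hg] using ha⟩) }
  have hvD : ∀ s x, v s x ∈ D s := fun s x => loc_one_mem_pullback.1 (hv s x)
  have hfv : f.mapEnv (fun s x => e s (v s x)) = fun s x => e' s (v s x) := by
    funext s x
    exact hge s _ (hvD s x)
  obtain ⟨F, -, hF⟩ := exists_finset_dsat (hN.2 N' hN' f Γ φ (fun s x => e s (v s x)) (hfv ▸ hφ))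
  exact hF _ cst e D v hc hcD (fun p _ => ⟨g _ p.2, hgD _ _, hg _ _⟩) hvD fun _ _ => rfl

/-! ### Bounded positively closed models give retractors -/

/-- Since `s` is smaller than `W`, its complement still has the size of `W` and has room for the
points of `P` outside the range of `f`. This names a larger model while keeping the names already in
use. -/
theorem exists_extension_injective {P W : Type u} [Infinite W]
    (hP : Cardinal.mk P < Cardinal.mk W) (s : Set W) (f : s → P) (hf : Function.Injective f) :
    ∃ j : P → W, Function.Injective j ∧ ∀ x : s, j (f x) = x := by
  classical
  have hs : Cardinal.mk s < Cardinal.mk W := (Cardinal.mk_le_of_injective hf).trans_lt hP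
  have hcompl : Cardinal.mk (sᶜ : Set W) = Cardinal.mk W := Cardinal.mk_compl_of_infinite s hs
  obtain ⟨k⟩ : Nonempty (((Set.range f)ᶜ : Set P) ↪ (sᶜ : Set W)) := by
    rw [← Cardinal.le_def, hcompl]
    exact (Cardinal.mk_set_le _).trans hP.le
  let j : P → W := fun y => if h : y ∈ Set.range f then (h.choose : W) else k ⟨y, h⟩
  have hj₁ : ∀ x : s, j (f x) = x := by
    intro x
    have h : f x ∈ Set.range f := ⟨x, rfl⟩
    have : h.choose = x := hf h.choose_spec
    simp only [j, dif_pos h, this]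
  have hj₂ : ∀ y (h : y ∉ Set.range f), j y = k ⟨y, h⟩ := fun y h => dif_neg h
  refine ⟨j, fun y z hyz => ?_, hj₁⟩
  by_cases hy : y ∈ Set.range f <;> by_cases hz : z ∈ Set.range f
  · obtain ⟨y, rfl⟩ := hy
    obtain ⟨z, rfl⟩ := hz
    rw [hj₁, hj₁] at hyz
    rw [Subtype.ext hyz]
  · obtain ⟨y, rfl⟩ := hy
    rw [hj₁, hj₂ z hz] at hyz
    exact absurd (hyz ▸ y.2) (k ⟨z, hz⟩).2
  · obtain ⟨z, rfl⟩ := hz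
    rw [hj₁, hj₂ y hy] at hyz
    exact absurd (hyz ▸ z.2) (k ⟨y, hy⟩).2
  · rw [hj₂ y hy, hj₂ z hz] at hyz
    simpa using k.injective (Subtype.ext hyz)

theorem Struc.mk_carrier_le_card (M : Struc L) (s : L.Sorts) :
    Cardinal.mk (M.carrier s) ≤ M.card :=
  Cardinal.mk_le_of_injective (sigma_mk_injective (i := s))

/-- If positively closed models are bounded in size, each of them maps to one all of whose
homomorphisms to positively closed models are surjective. -/
theorem exists_maximal_isPCModel {T : Set (NegSentence L)} {κ : Cardinal.{u}}
    (hκ : ∀ M : Struc L, IsPCModel T M → M.card < κ) {M : Struc L} (hM : IsPCModel T M) :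
    ∃ C : Struc L, IsPCModel T C ∧ Nonempty (Struc.Hom M C) ∧ ∀ P : Struc L, IsPCModel T P →
      ∀ f : Struc.Hom C P, ∀ s, Function.Surjective (f.toFun s) := by
  classical
  let W : Type u := (max κ Cardinal.aleph0).out
  have hW : Cardinal.mk W = max κ Cardinal.aleph0 := Cardinal.mk_out _
  have hWinf : Infinite W := Cardinal.infinite_iff.2 (hW ▸ le_max_right _ _)
  have hcard : ∀ P : Struc L, IsPCModel T P → ∀ s, Cardinal.mk (P.carrier s) < Cardinal.mk W :=
    fun P hP s => ((P.mk_carrier_le_card s).trans_lt (hκ P hP)).trans_le (hW ▸ le_max_left _ _)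
  have hcover : ∀ P : Struc L, IsPCModel T P → ∀ j : ∀ s, P.carrier s → W,
      (∀ s, Function.Injective (j s)) → ∃ e : ∀ s, W → P.carrier s, ∀ s a, e s (j s a) = a := by
    intro P _ j hj
    have := P.nonempty_carrier
    exact ⟨fun s => Function.invFun (j s), fun s => Function.leftInverse_invFun (hj s)⟩
  have hi : ∀ s, ∃ i : M.carrier s → W, Function.Injective i := fun s =>
    let ⟨i⟩ := Cardinal.le_def _ _ |>.1 (hcard M hM s).le
    ⟨i, i.injective⟩
  choose i hi using hi
  let cst : ∀ s, L.Const s → W := fun s c => i s (M.const c)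
  -- One name per element: duplicate names could exhaust `W` and leave no room to name an extension.
  let R : Set (Set (Atom L fun _ => W)) := {Δ | IsModelDiagram cst T Δ ∧ IsPCDiagram cst T Δ ∧
    ∀ (s : L.Sorts) (x y : W), Atom.loc (1 : L.Loc s) x y ∈ Δ → x = y}
  have hR : ∀ P : Struc L, IsPCModel T P → ∀ (j : ∀ s, P.carrier s → W)
      (e : ∀ s, W → P.carrier s), (∀ s a, e s (j s a) = a) →
      (∀ s (c : L.Const s), cst s c = j s (P.const c)) →
      pullback P e (fun s => Set.range (j s)) ∈ R := by
    intro P hP j e hej hcj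
    have hc : ∀ s c, e s (cst s c) = P.const c := fun s c => by rw [hcj, hej]
    have hcD : ∀ s c, cst s c ∈ Set.range (j s) := fun s c => ⟨_, (hcj s c).symm⟩
    refine ⟨isModelDiagram_pullback hP.1 hc
      (fun s => have := P.nonempty_carrier s; Set.range_nonempty _) hcD,
      hP.isPCDiagram_pullback hc hcD fun s a => ⟨_, ⟨a, rfl⟩, hej s a⟩, fun s x y hxy => ?_⟩
    obtain ⟨⟨⟨a, rfl⟩, ⟨b, rfl⟩⟩, hxy⟩ := mem_pullback.1 hxy
    have : e s (j s a) = e s (j s b) := (P.loc_one _ _).1 hxy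
    rw [hej, hej] at this
    rw [this]
  obtain ⟨e₀, he₀⟩ := hcover M hM i hi
  obtain ⟨Δ, hsub, hΔ⟩ := zorn_subset_nonempty R (fun c hc hchain hne =>
    ⟨⋃₀ c, ⟨IsModelDiagram.sUnion hchain hne fun Δ h => (hc h).1,
      IsPCDiagram.sUnion hchain hne fun Δ h => (hc h).2.1, by
      rintro s x y ⟨Δ, hΔ, h⟩
      exact (hc hΔ).2.2 s x y h⟩, fun Δ h => Set.subset_sUnion_of_mem h⟩) _
    (hR M hM i e₀ he₀ fun s c => rfl)
  have h := hΔ.prop.1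
  refine ⟨h.toStruc, hΔ.prop.2.1.isPCModel h, ⟨?_⟩, fun P hP f => ?_⟩
  · have hdom : ∀ {s} (a : M.carrier s), Atom.loc (1 : L.Loc s) (i s a) (i s a) ∈ Δ := fun a =>
      hsub (loc_one_mem_pullback.2 ⟨a, rfl⟩)
    exact
      { toFun := fun s a => h.elem (i s a) (hdom a)
        map_const := fun c => rfl
        map_rel := fun R t ht => (h.rel_elem R _ fun k => hdom (t k)).2
          (hsub (mem_pullback.2 ⟨fun k => ⟨_, rfl⟩, by simpa only [Atom.Holds, he₀] using ht⟩))
        map_loc := fun d a b hd => (h.loc_elem d (hdom a) (hdom b)).2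
          (hsub (mem_pullback.2 ⟨⟨⟨_, rfl⟩, ⟨_, rfl⟩⟩,
            by simpa only [Atom.Holds, he₀] using hd⟩)) }
  · have hf := (hΔ.prop.2.1.isPCModel h).2 P hP.1 f
    -- `P` is redrawn inside `W` over `Δ`. By maximality its diagram equals `Δ`, so every element of
    -- `P` already has a name there and is in the image of `f`.
    have hj : ∀ s, ∃ j : P.carrier s → W, Function.Injective j ∧
        ∀ x hx, j (f.toFun s (h.elem (Y := fun _ => W) x hx)) = x := by
      intro s
      obtain ⟨j, hj, hjx⟩ := exists_extension_injective (hcard P hP s)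
        {x : W | Atom.loc (Y := fun _ => W) (1 : L.Loc s) x x ∈ Δ}
        (fun x => f.toFun s (h.elem (Y := fun _ => W) x.1 x.2)) (by
          intro x y hxy
          exact Subtype.ext (hΔ.prop.2.2 s _ _ (h.elem_eq.1 (hf.injective s hxy))))
      exact ⟨j, hj, fun x hx => hjx ⟨x, hx⟩⟩
    choose j hj hjx using hj
    obtain ⟨e, he⟩ := hcover P hP j hj
    have hex : ∀ s x hx, e s x = f.toFun s (h.elem (Y := fun _ => W) x hx) := fun s x hx =>
      (congrArg (e s) (hjx s x hx)).symm.trans (he s _)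
    obtain ⟨e', hce', he', hee'⟩ := h.exists_interpretation f
    have hmem := hR P hP j e he fun s c => by
      rw [← f.map_const]
      exact (hjx s _ (h.const_dom c)).symm
    have hsub' : Δ ⊆ pullback P e fun s => Set.range (j s) := by
      refine subset_pullback h (fun s x hx => ⟨_, hjx s x hx⟩) fun α hα => ?_
      exact (he' α hα).congr (h.on_dom hα) fun s x hx => (hee' s x hx).trans (hex s x hx).symm
    have heq := hΔ.eq_of_subset hmem hsub'
    intro s a
    have ha : Atom.loc (1 : L.Loc s) (j s a) (j s a) ∈ Δ :=
      heq ▸ loc_one_mem_pullback.2 ⟨a, rfl⟩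
    exact ⟨h.elem _ ha, hj s (hjx s _ ha)⟩

/-- Continue `N` to a pc model: the composite from `C` is a surjective positive embedding, and its
inverse restricts to a retraction of `f`. -/
theorem IsPCModel.isRetractor_of_surjective {T : Set (NegSentence L)} {C : Struc L}
    (hC : IsPCModel T C) (hs : ∀ P : Struc L, IsPCModel T P → ∀ f : Struc.Hom C P, ∀ s,
      Function.Surjective (f.toFun s)) : IsRetractor T C := by
  refine ⟨hC.1, fun N hN f => ?_⟩
  obtain ⟨P, hP, ⟨g⟩⟩ := exists_hom_isPCModel hN
  obtain ⟨r, hr⟩ := (hC.2 P hP.1 (g.comp f)).exists_inverse (hs P hP _)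
  exact ⟨r.comp g, hr⟩

theorem hasRetractors_of_card_lt {T : Set (NegSentence L)} {κ : Cardinal.{u}}
    (hκ : ∀ M : Struc L, IsPCModel T M → M.card < κ) : HasRetractors T := by
  intro M hM
  obtain ⟨P, hP, ⟨f⟩⟩ := exists_hom_isPCModel hM
  obtain ⟨C, hC, ⟨g⟩, hs⟩ := exists_maximal_isPCModel hκ hP
  exact ⟨C, hC.isRetractor_of_surjective hs, C, hC.1, ⟨g.comp f⟩,
    ⟨⟨fun _ a => a, fun _ => rfl, fun _ _ h => h, fun _ _ _ h => h⟩⟩⟩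

/-! ### Retractors bound positively closed models -/

theorem Struc.Sat.map {M N : Struc L} (f : Struc.Hom M N) {Γ : List L.Sorts} {φ : PosFormula L Γ}
    {v : M.Env Γ} : M.Sat φ v → N.Sat φ (f.mapEnv v) := by
  have hterm : ∀ {Γ : List L.Sorts} (v : M.Env Γ) {s : L.Sorts} (t : Term L Γ s),
      N.eval (f.mapEnv v) t = f.toFun s (M.eval v t) := by
    intro Γ v s t
    cases t with
    | var x => rfl
    | const c => exact (f.map_const c).symm
  induction φ with
  | rel R t =>
    intro h
    simpa only [Struc.Sat, hterm] using f.map_rel R _ h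
  | loc d t₁ t₂ =>
    intro h
    simpa only [Struc.Sat, hterm] using f.map_loc d _ _ h
  | and φ ψ ih₁ ih₂ => exact And.imp ih₁ ih₂
  | or φ ψ ih₁ ih₂ => exact Or.imp ih₁ ih₂
  | ex s φ ih =>
    rintro ⟨a, ha⟩
    refine ⟨f.toFun s a, ?_⟩
    have hcons : f.mapEnv (Struc.Env.cons a v) = Struc.Env.cons (f.toFun s a) (f.mapEnv v) := by
      funext t x
      cases x <;> rfl
    exact hcons ▸ ih ha

/-- A retraction carries the truth of a positive formula back from `N` to `C`. -/
theorem IsRetractor.isPCModel {T : Set (NegSentence L)} {C : Struc L} (hC : IsRetractor T C) :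
    IsPCModel T C := by
  refine ⟨hC.1, fun N hN f Γ φ v hφ => ?_⟩
  obtain ⟨g, hg⟩ := hC.2 N hN f
  have hv : g.mapEnv (f.mapEnv v) = v := by
    funext s x
    exact hg s _
  exact hv ▸ hφ.map g

theorem HasRetractors.card_le {T : Set (NegSentence L)} (h : HasRetractors T) {κ : Cardinal.{u}}
    (hκ : ∀ C : Struc L, IsRetractor T C → C.card ≤ κ) {M : Struc L} (hM : IsPCModel T M) :
    M.card ≤ κ := by
  obtain ⟨C, hC, N, hN, ⟨f⟩, ⟨g⟩⟩ := h M hM.1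
  obtain ⟨r, -⟩ := hC.2 N hN g
  refine le_trans (Cardinal.mk_le_of_injective
    (f := Sigma.map id (r.comp f).toFun) ?_) (hκ C hC)
  exact Function.injective_id.sigma_map (hM.2 C hC.1 (r.comp f)).injective

end LocalLanguage
-- The Erdős–Rado theorem
open Cardinal in
/-- The Erdős–Rado theorem `(2 ^ κ)⁺ → (ω)²_κ` for colourings of ordered pairs. -/
theorem Cardinal.exists_homogeneous_seq {X K : Type u} {κ : Cardinal.{u}} (hκ : ℵ₀ ≤ κ)
    (hK : #K ≤ κ) (hX : 2 ^ κ < #X) (c : X → X → K) :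
    ∃ (k : K) (a : ℕ → X), ∀ i j, i < j → a i ≠ a j ∧ c (a i) (a j) = k := by
  classical
  have hXne : Nonempty X := mk_ne_zero_iff.1 (bot_le.trans_lt hX).ne'
  let O : Type u := (Order.succ κ).ord.ToType
  have hO : #O = Order.succ κ := mk_ord_toType _
  have hIio : ∀ α : O, #(Set.Iio α) ≤ κ := fun α =>
    Order.lt_succ_iff.1 (by simpa [O] using mk_Iio_lt α (by simp [O]))
  let S : X → (α : O) → (∀ β : O, β < α → X) → Set X := fun x α g =>
    {z | ∀ β (h : β < α), z ≠ g β h ∧ c (g β h) z = c (g β h) x}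
  -- The branch of `x` in the Erdős–Rado tree: the next point is a fixed choice among the points
  -- that are new and that the earlier ones colour as they colour `x`. It depends on `x` only
  -- through these colours.
  let g : X → O → X := fun x => WellFounded.fix (r := (· < · : O → O → Prop)) wellFounded_lt
    fun α g => Classical.epsilon (· ∈ S x α g)
  have hg : ∀ x α, g x α = Classical.epsilon (· ∈ S x α fun β _ => g x β) := fun x α =>
    WellFounded.fix_eq _ _ _
  -- If a branch never meets `x`, then `x` itself is always a candidate, so the branch has length
  -- `κ⁺` and each pair's colour depends only on its earlier point; the pigeonhole principle
  -- finishes.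
  by_cases hx : ∃ x, ∀ α, g x α ≠ x
  · obtain ⟨x, hx⟩ := hx
    have hgS : ∀ α, g x α ∈ S x α fun β _ => g x β := by
      intro α
      rw [hg x α]
      exact Classical.epsilon_spec (p := (· ∈ S x α fun β _ => g x β))
        ⟨x, fun β _ => ⟨(hx β).symm, rfl⟩⟩
    have : Infinite O := infinite_iff.2 (hO ▸ hκ.trans (Order.le_succ κ))
    obtain ⟨k, hk⟩ := exists_infinite_fiber (fun α : O => c (g x α) x)
      (hO ▸ hK.trans_lt (Order.lt_succ κ))
    let f₀ := Infinite.natEmbedding ((fun α : O => c (g x α) x) ⁻¹' {k})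
    let f : ℕ → O := fun n => (f₀ n).1
    have hfk : ∀ n, c (g x (f n)) x = k := fun n => (f₀ n).2
    have hfi : Function.Injective f := Subtype.val_injective.comp f₀.injective
    obtain ⟨m, hm⟩ := exists_increasing_or_nonincreasing_subseq (· < ·) f
    have hm : ∀ i j, i < j → f (m i) < f (m j) := by
      obtain hm | hm := hm
      · exact hm
      · have hdec : ∀ i j, i < j → f (m j) < f (m i) := fun i j hij =>
          lt_of_le_of_ne (not_lt.1 (hm i j hij)) (hfi.ne (m.injective.ne hij.ne'))
        exact ((RelEmbedding.natGT (fun n => f (m n)) fun n =>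
          hdec _ _ n.lt_succ_self).not_wellFounded wellFounded_lt).elim
    exact ⟨k, fun n => g x (f (m n)), fun i j hij =>
      ⟨((hgS _ _ (hm i j hij)).1).symm, ((hgS _ _ (hm i j hij)).2).trans (hfk _)⟩⟩
  -- Otherwise each `x` is determined by its level and the colours below it, which leaves at most
  -- `κ⁺ * κ ^ κ = 2 ^ κ` points.
  · push Not at hx
    choose α hα using hx
    let F : X → Σ β : O, (Set.Iio β → K) := fun x => ⟨α x, fun β => c (g x β) x⟩
    have hF : Function.Injective F := by
      intro x y hxy
      have key : ∀ (γ : O), F x = F y → γ ≤ α x → g x γ = g y γ := by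
        intro γ h
        induction γ using WellFoundedLT.induction with
        | ind γ ih =>
          intro hγ
          have hS : (S x γ fun β _ => g x β) = S y γ fun β _ => g y β := by
            ext z
            refine forall_congr' fun β => forall_congr' fun hβ => ?_
            have hβx := hβ.trans_le hγ
            have hβg := ih β hβ hβx.le
            have hc : c (g x β) x = c (g y β) y := by
              have aux : ∀ p q : (Σ β : O, (Set.Iio β → K)), p = q → ∀ h₁ h₂,
                  p.2 ⟨β, h₁⟩ = q.2 ⟨β, h₂⟩ := by rintro p _ rfl h₁ h₂; rfl
              exact aux _ _ h hβx
                (hβx.trans_eq (show α x = α y from congrArg Sigma.fst h))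
            change z ≠ g x β ∧ c (g x β) z = c (g x β) x ↔ z ≠ g y β ∧ c (g y β) z = c (g y β) y
            rw [hc, hβg]
          rw [hg, hg, hS]
      have h := key (α x) hxy le_rfl
      rw [hα, show α x = α y from congrArg Sigma.fst hxy, hα] at h
      exact h
    have hle : #X ≤ 2 ^ κ := by
      refine (mk_le_of_injective hF).trans ?_
      rw [mk_sigma]
      refine (sum_le_sum _ (fun _ => 2 ^ κ) fun β => ?_).trans ?_
      · rw [← power_def]
        calc #K ^ #(Set.Iio β) ≤ κ ^ #(Set.Iio β) := power_le_power_right hK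
          _ ≤ κ ^ κ := power_le_power_left (aleph0_pos.trans_le hκ).ne' (hIio β)
          _ = 2 ^ κ := power_self_eq hκ
      · rw [sum_const', hO]
        have h₁ : Order.succ κ ≤ 2 ^ κ := Order.succ_le_of_lt (cantor κ)
        exact (mul_le_mul' h₁ le_rfl).trans (mul_eq_self (hκ.trans (cantor κ).le)).le
    exact absurd hX hle.not_gt
namespace LocalLanguage

open Filter

variable {L : LocalLanguage.{u}}

/-! ### Separating patterns -/

/-- An interpretation of names, extended to the constants of the language. -/
def withConst (N : Struc L) {Y : L.Sorts → Type u} (e : ∀ s, Y s → N.carrier s) :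
    ∀ s, Y s ⊕ L.Const s → N.carrier s :=
  fun s => Sum.elim (e s) N.const

theorem IsModelDiagram.holds_elem {Y : L.Sorts → Type u} {cst : ∀ s, L.Const s → Y s}
    {T : Set (NegSentence L)} {Δ : Set (Atom L Y)} (h : IsModelDiagram cst T Δ)
    (hdom : ∀ s (x : Y s), .loc 1 x x ∈ Δ) {α : Atom L Y} :
    α.Holds h.toStruc (fun s x => h.elem x (hdom s x)) ↔ α ∈ Δ := by
  cases α with
  | rel R t => exact h.rel_elem R t fun i => hdom _ _
  | loc d x y => exact h.loc_elem d (hdom _ x) (hdom _ y)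

theorem Atom.on_univ {Y : L.Sorts → Type u} (α : Atom L Y) : α.On fun _ => Set.univ := by
  cases α with
  | rel R t => exact fun i => Set.mem_univ _
  | loc d x y => exact ⟨Set.mem_univ _, Set.mem_univ _⟩

/-- Distinct elements of a positively closed model are kept apart by finitely many atomic facts. -/
theorem IsPCModel.exists_separating {T : Set (NegSentence L)} {C : Struc L} (hC : IsPCModel T C)
    {s : L.Sorts} {a b : C.carrier s} (hab : a ≠ b) :
    ∃ p : List (Atom L fun s => C.carrier s ⊕ L.Const s),
      (∀ α ∈ p, α.Holds C (withConst C fun _ x => x)) ∧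
      ∀ N : Struc L, IsLocalModel T N → ∀ e : ∀ s, C.carrier s → N.carrier s,
        (∀ α ∈ p, α.Holds N (withConst N e)) → e s a ≠ e s b := by
  classical
  by_contra! hcon
  -- Compactness: the counterexamples indexed by finite sets of facts true in `C` have a reduced
  -- product that receives `C` and identifies `a` with `b`. It is local because the distances in `C`
  -- are among these facts.
  let A := {α : Atom L (fun s => C.carrier s ⊕ L.Const s) // α.Holds C (withConst C fun _ x => x)}
  have hsat : ∀ F : Finset A, ∃ N : Struc L, IsLocalModel T N ∧
      ∃ e : ∀ s, C.carrier s → N.carrier s,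
        (∀ α ∈ F, α.1.Holds N (withConst N e)) ∧ e s a = e s b := by
    intro F
    obtain ⟨N, hN, e, he, heq⟩ := hcon (F.toList.map Subtype.val) (by
      intro α hα
      obtain ⟨β, -, rfl⟩ := List.mem_map.1 hα
      exact β.2)
    exact ⟨N, hN, e, fun α hα => he _ (List.mem_map.2 ⟨α, Finset.mem_toList.2 hα, rfl⟩), heq⟩
  choose N hN e he heq using hsat
  have hev : ∀ α : Atom L (fun s => C.carrier s ⊕ L.Const s),
      α.Holds C (withConst C fun _ x => x) →
        ∀ᶠ F : Finset A in atTop, α.Holds (N F) (withConst (N F) (e F)) := by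
    intro α hα
    filter_upwards [eventually_ge_atTop {⟨α, hα⟩}] with F hF
    exact he F ⟨α, hα⟩ (Finset.singleton_subset_iff.1 hF)
  let Δ := reducedDiagram atTop N (fun F => withConst (N F) (e F)) fun _ => Set.univ
  have h : IsModelDiagram (fun _ c => Sum.inr c) T Δ :=
    isModelDiagram_reducedDiagram hN (fun F s c => rfl)
      (fun s => let ⟨x⟩ := C.nonempty_carrier s; ⟨.inl x, trivial⟩) (fun s c => trivial)
      fun s x _ y _ => by
        obtain ⟨d, hd⟩ := hC.1.1.exists_loc (withConst C (fun _ x => x) s x)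
          (withConst C (fun _ x => x) s y)
        exact ⟨d, hev (.loc d x y) hd⟩
  have hmem : ∀ α : Atom L (fun s => C.carrier s ⊕ L.Const s),
      α.Holds C (withConst C fun _ x => x) → α ∈ Δ := fun α hα => ⟨α.on_univ, hev α hα⟩
  have hdom : ∀ s (x : C.carrier s ⊕ L.Const s), .loc 1 x x ∈ Δ := fun s x =>
    loc_one_mem_reducedDiagram.2 trivial
  let f : Struc.Hom C h.toStruc :=
    { toFun := fun s x => h.elem (Y := fun s => C.carrier s ⊕ L.Const s) (.inl x) (hdom s _)
      map_const := fun {s} c => h.elem_eq.2 (hmem (.loc 1 (.inl (C.const c)) (.inr c))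
        ((C.loc_one _ _).2 rfl))
      map_rel := fun R t ht => (h.holds_elem hdom (α := .rel R fun i => .inl (t i))).2
        (hmem _ ht)
      map_loc := fun d x y hd => (h.holds_elem hdom (α := .loc d (.inl x) (.inl y))).2
        (hmem _ hd) }
  refine hab ((hC.2 _ h.isLocalModel_toStruc f).injective s (h.elem_eq.2 ?_))
  exact ⟨⟨trivial, trivial⟩, Eventually.of_forall fun F => ((N F).loc_one _ _).2 (heq F)⟩

/-- A finite list of atomic conditions on countably many variables of each sort, with a locality
bound for finitely many of the variables, and two distinguished variables. -/
structure Pattern (L : LocalLanguage.{u}) : Type u where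
  facts : List (Atom L fun s => ULift.{u} ℕ ⊕ L.Const s)
  bounds : List (Σ s, ULift.{u} ℕ × L.Loc s)
  fst : ULift.{u} ℕ
  snd : ULift.{u} ℕ

namespace Pattern

open Classical in
/-- The locality bound on a variable; variables without a given bound are bounded by equality. -/
noncomputable def bound (q : Pattern L) (s : L.Sorts) (n : ULift.{u} ℕ) : L.Loc s :=
  if h : ∃ d, ⟨s, n, d⟩ ∈ q.bounds then h.choose else 1

/-- The tuple `e` satisfies the conditions of the pattern. -/
def Sat (q : Pattern L) (N : Struc L) (e : ∀ s, ULift.{u} ℕ → N.carrier s) : Prop :=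
  ∀ α ∈ q.facts, α.Holds N (withConst N e)

/-- The conditions of the pattern are inconsistent with the equality of the distinguished
variables of sort `s`. -/
def Separates (q : Pattern L) (T : Set (NegSentence L)) (s : L.Sorts) : Prop :=
  ∀ N : Struc L, IsLocalModel T N → ∀ e, q.Sat N e → e s q.fst ≠ e s q.snd

/-- The tuple `e` satisfies the conditions of the pattern, with distinguished entries `a` and `b`,
and is bounded around the base points `o`. -/
structure Realizes (q : Pattern L) (C : Struc L) (o : ∀ s, C.carrier s) {s : L.Sorts}
    (a b : C.carrier s) (e : ∀ s, ULift.{u} ℕ → C.carrier s) : Prop where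
  sat : q.Sat C e
  loc : ∀ t n, C.loc (q.bound t n) (o t) (e t n)
  fst : e s q.fst = a
  snd : e s q.snd = b

end Pattern

theorem Struc.IsLocal.refl {C : Struc L} (hC : C.IsLocal) {s : L.Sorts} (d : L.Loc s)
    (a : C.carrier s) : C.loc d a a :=
  hC.mono 1 d (L.loc_one_le s d) a a ((C.loc_one a a).2 rfl)

/-- Replaces the finitely many elements in a separating list by numbered variables and records their
distances from the base points; the result no longer depends on the elements of `C`, so patterns can
serve as colours. -/
theorem IsPCModel.exists_pattern {T : Set (NegSentence L)} {C : Struc L} (hC : IsPCModel T C)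
    (o : ∀ s, C.carrier s) {s : L.Sorts} {a b : C.carrier s} (hab : a ≠ b) :
    ∃ q : Pattern L, q.Separates T s ∧ ∃ e, q.Realizes C o a b e := by
  classical
  obtain ⟨p, hp, hsep⟩ := hC.exists_separating hab
  let ι : (Σ t, C.carrier t) → Σ t, C.carrier t ⊕ L.Const t := Sigma.map id fun _ => Sum.inl
  have hι : Function.Injective ι := Function.injective_id.sigma_map fun _ => Sum.inl_injective
  let S : Set (Σ t, C.carrier t) :=
    insert ⟨s, a⟩ (insert ⟨s, b⟩ (ι ⁻¹' {x | x ∈ p.flatMap Atom.names}))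
  have hS : S.Finite :=
    (((List.finite_toSet (p.flatMap Atom.names)).preimage hι.injOn).insert _).insert _
  obtain ⟨g, hg⟩ := Set.countable_iff_exists_injOn.1 hS.countable
  -- Unused variables sit at the base point, which agrees with their default bound, equality.
  let e : ∀ t, ULift.{u} ℕ → C.carrier t := fun t n =>
    if h : ∃ c, ⟨t, c⟩ ∈ S ∧ g ⟨t, c⟩ = n.down then h.choose else o t
  have he : ∀ t c, ⟨t, c⟩ ∈ S → e t ⟨g ⟨t, c⟩⟩ = c := by
    intro t c hc
    have h : ∃ c', ⟨t, c'⟩ ∈ S ∧ g ⟨t, c'⟩ = g ⟨t, c⟩ := ⟨c, hc, rfl⟩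
    have h' : h.choose = c := by
      have := hg h.choose_spec.1 hc h.choose_spec.2
      exact eq_of_heq (Sigma.mk.inj this).2
    exact (dif_pos h).trans h'
  choose dist hdist using fun t c => hC.1.1.exists_loc (o t) c
  let ρ : ∀ t, C.carrier t ⊕ L.Const t → ULift.{u} ℕ ⊕ L.Const t := fun t =>
    Sum.map (fun c => ⟨g ⟨t, c⟩⟩) id
  have hρ : ∀ (N : Struc L) (e' : ∀ t, ULift.{u} ℕ → N.carrier t),
      (fun t x => withConst N e' t (ρ t x)) = withConst N fun t c => e' t ⟨g ⟨t, c⟩⟩ := by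
    intro N e'
    funext t x
    cases x <;> rfl
  let q : Pattern L :=
    { facts := p.map (Atom.map ρ)
      bounds := hS.toFinset.toList.map fun x => ⟨x.1, ⟨g x⟩, dist x.1 x.2⟩
      fst := ⟨g ⟨s, a⟩⟩
      snd := ⟨g ⟨s, b⟩⟩ }
  refine ⟨q, fun N hN e' he' => hsep N hN (fun t c => e' t ⟨g ⟨t, c⟩⟩) fun α hα => ?_, e, ?_, ?_,
    he s a (.inl rfl), he s b (.inr (.inl rfl))⟩
  · have := he' _ (List.mem_map.2 ⟨α, hα, rfl⟩)
    rwa [Atom.holds_map, hρ] at this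
  · intro β hβ
    obtain ⟨α, hα, rfl⟩ := List.mem_map.1 hβ
    rw [Atom.holds_map, hρ]
    refine (hp α hα).congr α.on_names fun t x hx => ?_
    cases x with
    | inl c =>
      exact (he t c (.inr (.inr (List.mem_flatMap.2 ⟨α, hα, hx⟩)))).symm
    | inr c => rfl
  · intro t n
    by_cases h : ∃ d, (⟨t, n, d⟩ : Σ s, ULift.{u} ℕ × L.Loc s) ∈ q.bounds
    · have hb : q.bound t n = h.choose := dif_pos h
      rw [hb]
      obtain ⟨⟨t', c⟩, hc, heq⟩ := List.mem_map.1 h.choose_spec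
      generalize h.choose = d at heq ⊢
      cases heq
      rw [he _ c (hS.mem_toFinset.1 (Finset.mem_toList.1 hc))]
      exact hdist _ c
    · have hb : q.bound t n = 1 := dif_neg h
      rw [hb]
      have hn : e t n = o t := by
        refine dif_neg ?_
        rintro ⟨c, hc, hcn⟩
        refine h ⟨dist t c, List.mem_map.2 ⟨⟨t, c⟩, Finset.mem_toList.2 (hS.mem_toFinset.2 hc), ?_⟩⟩
        rw [hcn]
      rw [hn]
      exact (C.loc_one _ _).2 rfl

/-! ### Counting patterns -/

section Card

open Cardinal

theorem aleph0_le_card (L : LocalLanguage.{u}) : ℵ₀ ≤ L.card := le_max_left _ _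

theorem mk_const_le_card (L : LocalLanguage.{u}) : #(Σ s, L.Const s) ≤ L.card :=
  (mk_le_of_injective (Sum.inl_injective)).trans (le_max_right _ _)

theorem mk_rel_le_card (L : LocalLanguage.{u}) : #(Σ ar, L.Rel ar) ≤ L.card :=
  (mk_le_of_injective (Sum.inr_injective.comp Sum.inl_injective)).trans (le_max_right _ _)

theorem mk_loc_le_card (L : LocalLanguage.{u}) : #(Σ s, L.Loc s) ≤ L.card :=
  (mk_le_of_injective (Sum.inr_injective.comp Sum.inr_injective)).trans (le_max_right _ _)

/-- Each sort contributes its own equality symbol. -/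
theorem mk_sorts_le_card (L : LocalLanguage.{u}) : #L.Sorts ≤ L.card :=
  (mk_le_of_injective (f := fun s => (⟨s, 1⟩ : Σ s, L.Loc s)) fun _ _ h =>
    congrArg Sigma.fst h).trans L.mk_loc_le_card

theorem mk_prod_le {A B : Type u} {κ : Cardinal.{u}} (hκ : ℵ₀ ≤ κ) (hA : #A ≤ κ) (hB : #B ≤ κ) :
    #(A × B) ≤ κ := by
  rw [mk_prod, lift_id, lift_id]
  exact mul_le_of_le hκ hA hB

theorem mk_sum_le {A B : Type u} {κ : Cardinal.{u}} (hκ : ℵ₀ ≤ κ) (hA : #A ≤ κ) (hB : #B ≤ κ) :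
    #(A ⊕ B) ≤ κ := by
  rw [mk_sum, lift_id, lift_id]
  exact add_le_of_le hκ hA hB

theorem mk_list_le {A : Type u} {κ : Cardinal.{u}} (hκ : ℵ₀ ≤ κ) (hA : #A ≤ κ) :
    #(List A) ≤ κ :=
  (mk_list_le_max A).trans (max_le hκ hA)

theorem mk_atom_le_card {Y : L.Sorts → Type u} (hY : #(Σ s, Y s) ≤ L.card) :
    #(Atom L Y) ≤ L.card := by
  let f : Atom L Y → ((Σ ar, L.Rel ar) ⊕ Σ s, L.Loc s) × List (Σ s, Y s) := fun α =>
    (match α with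
      | .rel (ar := ar) R _ => .inl ⟨ar, R⟩
      | .loc (s := s) d _ _ => .inr ⟨s, d⟩, α.names)
  refine (mk_le_of_injective (f := f) ?_).trans
    (mk_prod_le L.aleph0_le_card (mk_sum_le L.aleph0_le_card L.mk_rel_le_card L.mk_loc_le_card)
      (mk_list_le L.aleph0_le_card hY))
  rintro (⟨R, t⟩ | ⟨d, x, y⟩) (⟨R', t'⟩ | ⟨d', x', y'⟩) h
  · obtain ⟨h₁, h₂⟩ := Prod.mk.inj h
    cases h₁
    have := List.ofFn_injective h₂
    congr
    funext i
    exact eq_of_heq (Sigma.mk.inj (congrFun this i)).2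
  · cases (Prod.mk.inj h).1
  · cases (Prod.mk.inj h).1
  · obtain ⟨h₁, h₂⟩ := Prod.mk.inj h
    cases h₁
    simp only [Atom.names, List.cons.injEq, Sigma.mk.injEq, heq_eq_eq, true_and, and_true] at h₂
    rw [h₂.1, h₂.2]

theorem mk_pattern_le_card (L : LocalLanguage.{u}) : #(Pattern L) ≤ L.card := by
  have h₀ := L.aleph0_le_card
  have hN : #(ULift.{u} ℕ) ≤ L.card := by simpa using h₀
  have hvar : #(Σ s, ULift.{u} ℕ ⊕ L.Const s) ≤ L.card := by
    refine (mk_le_of_injective (β := (L.Sorts × ULift.{u} ℕ) ⊕ Σ s, L.Const s)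
      (f := fun x => match x with
        | ⟨s, .inl n⟩ => .inl (s, n)
        | ⟨s, .inr c⟩ => .inr ⟨s, c⟩) ?_).trans
      (mk_sum_le h₀ (mk_prod_le h₀ L.mk_sorts_le_card hN) L.mk_const_le_card)
    rintro ⟨s, n | c⟩ ⟨s', n' | c'⟩ h <;> cases h <;> rfl
  have hbd : #(Σ s, ULift.{u} ℕ × L.Loc s) ≤ L.card := by
    refine (mk_le_of_injective (β := ULift.{u} ℕ × Σ s, L.Loc s)
      (f := fun x => (x.2.1, ⟨x.1, x.2.2⟩)) ?_).trans (mk_prod_le h₀ hN L.mk_loc_le_card)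
    rintro ⟨s, n, d⟩ ⟨s', n', d'⟩ h
    cases h
    rfl
  refine (mk_le_of_injective (f := fun q : Pattern L => (q.facts, q.bounds, q.fst, q.snd)) ?_).trans
    (mk_prod_le h₀ (mk_list_le h₀ (mk_atom_le_card hvar))
      (mk_prod_le h₀ (mk_list_le h₀ hbd) (mk_prod_le h₀ hN hN)))
  rintro ⟨_, _, _, _⟩ ⟨_, _, _, _⟩ h
  cases h
  rfl

end Card

/-! ### Stretching sequences in a retractor -/

/-- The number of elements of a finite set below a given one. -/
def rankIn {J : Type u} [LinearOrder J] (j : J) (F : Finset J) : ℕ := (F.filter (· < j)).card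

/-- Ranks in large finite sets turn an increasing pair of `J` into an increasing pair of ℕ, and so
into a pair of terms of the sequence. -/
theorem rankIn_lt {J : Type u} [LinearOrder J] {j j' : J} (h : j < j') {F : Finset J}
    (hj : j ∈ F) : rankIn j F < rankIn j' F := by
  refine Finset.card_lt_card (Finset.ssubset_iff_subset_ne.2 ⟨fun x hx => ?_, fun heq => ?_⟩)
  · obtain ⟨hx, hxj⟩ := Finset.mem_filter.1 hx
    exact Finset.mem_filter.2 ⟨hx, hxj.trans h⟩
  · have : j ∈ F.filter (· < j) := heq ▸ Finset.mem_filter.2 ⟨hj, h⟩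
    exact lt_irrefl j (Finset.mem_filter.1 this).2

/-- In a retractor, a sequence all of whose increasing pairs realize the same separating pattern
can be stretched to the length of any linear order. -/
theorem IsRetractor.exists_injective {T : Set (NegSentence L)} {C : Struc L}
    (hC : IsRetractor T C) (o : ∀ s, C.carrier s) {s : L.Sorts} {q : Pattern L}
    (hq : q.Separates T s) {a : ℕ → C.carrier s}
    (ha : ∀ i j, i < j → ∃ e, q.Realizes C o (a i) (a j) e) (J : Type u) [LinearOrder J] :
    ∃ b : J → C.carrier s, Function.Injective b := by
  classical
  -- Base points serve when `i < j` fails, so that the witness functions below are bounded at every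
  -- finite set and not just eventually.
  have hE : ∀ i j, ∃ e : ∀ s, ULift.{u} ℕ → C.carrier s,
      (∀ t n, C.loc (q.bound t n) (o t) (e t n)) ∧ (i < j → q.Realizes C o (a i) (a j) e) := by
    intro i j
    by_cases hij : i < j
    · obtain ⟨e, he⟩ := ha i j hij
      exact ⟨e, he.loc, fun _ => he⟩
    · exact ⟨fun t _ => o t, fun t n => hC.1.1.refl _ _, fun h => absurd h hij⟩
  choose E hEloc hE using hE
  -- Only functions that stay within a fixed distance of the base point are kept; this makes the
  -- reduced power satisfy (A5).
  let Y : L.Sorts → Type u := fun t =>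
    {x : Finset J → C.carrier t // ∃ d, ∀ F, C.loc d (o t) (x F)}
  let ofElem : ∀ t, C.carrier t → Y t := fun t c =>
    ⟨fun _ => c, let ⟨d, hd⟩ := hC.1.1.exists_loc (o t) c; ⟨d, fun _ => hd⟩⟩
  let Δ : Set (Atom L Y) := reducedDiagram atTop (fun _ : Finset J => C) (fun F _ x => x.1 F)
    fun _ => Set.univ
  have h : IsModelDiagram (fun t c => ofElem t (C.const c)) T Δ :=
    isModelDiagram_reducedDiagram (fun _ => hC.1) (fun _ _ _ => rfl)
      (fun t => ⟨ofElem t (o t), trivial⟩) (fun _ _ => trivial) fun t x _ y _ => by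
        obtain ⟨d, hd⟩ := x.2
        obtain ⟨d', hd'⟩ := y.2
        exact ⟨d * d', Eventually.of_forall fun F =>
          hC.1.1.comp _ _ _ _ _ (hC.1.1.symm _ _ _ (hd F)) (hd' F)⟩
  have hdom : ∀ t (x : Y t), .loc 1 x x ∈ Δ := fun t x => loc_one_mem_reducedDiagram.2 trivial
  let f : Struc.Hom C h.toStruc :=
    { toFun := fun t c => h.elem (ofElem t c) (hdom t _)
      map_const := fun c => rfl
      map_rel := fun R t ht => (h.holds_elem hdom (α := .rel R fun i => ofElem _ (t i))).2
        ⟨fun _ => trivial, Eventually.of_forall fun _ => ht⟩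
      map_loc := fun d x y hd => (h.holds_elem hdom (α := .loc d (ofElem _ x) (ofElem _ y))).2
        ⟨⟨trivial, trivial⟩, Eventually.of_forall fun _ => hd⟩ }
  obtain ⟨r, -⟩ := hC.2 _ h.isLocalModel_toStruc f
  let b : J → Y s := fun j => ⟨fun F => a (rankIn j F), q.bound s q.fst, fun F => by
    have := hEloc (rankIn j F) (rankIn j F + 1) s q.fst
    rwa [(hE _ _ (Nat.lt_succ_self (rankIn j F))).fst] at this⟩
  let w : J → J → ∀ t, ULift.{u} ℕ → Y t := fun j j' t n =>
    ⟨fun F => E (rankIn j F) (rankIn j' F) t n, q.bound t n, fun F => hEloc _ _ _ _⟩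
  have key : ∀ j j', j < j' →
      r.toFun s (h.elem (b j) (hdom s _)) ≠ r.toFun s (h.elem (b j') (hdom s _)) := by
    intro j j' hjj'
    have hev : ∀ᶠ F : Finset J in atTop, q.Realizes C o (a (rankIn j F)) (a (rankIn j' F))
        (E (rankIn j F) (rankIn j' F)) := by
      filter_upwards [eventually_ge_atTop {j}] with F hF
      exact hE _ _ (rankIn_lt hjj' (Finset.singleton_subset_iff.1 hF))
    have h₁ : h.elem (w j j' s q.fst) (hdom s _) = h.elem (b j) (hdom s _) :=
      h.elem_eq.2 ⟨⟨trivial, trivial⟩, hev.mono fun F hF => (C.loc_one _ _).2 hF.fst⟩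
    have h₂ : h.elem (w j j' s q.snd) (hdom s _) = h.elem (b j') (hdom s _) :=
      h.elem_eq.2 ⟨⟨trivial, trivial⟩, hev.mono fun F hF => (C.loc_one _ _).2 hF.snd⟩
    -- The pattern consists of atomic facts, so the homomorphism `r` carries it back to `C`, where
    -- it separates the images of `b j` and `b j'`.
    have hsat : q.Sat C fun t n => r.toFun t (h.elem (w j j' t n) (hdom t _)) := by
      intro α hα
      let ρ : ∀ t, ULift.{u} ℕ ⊕ L.Const t → Y t := fun t =>
        Sum.elim (w j j' t) fun c => ofElem t (C.const c)
      have hmem : α.map ρ ∈ Δ := by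
        refine ⟨Atom.on_univ _, hev.mono fun F hF => ?_⟩
        rw [Atom.holds_map]
        have hρ : (fun t x => (ρ t x).1 F) = withConst C (E (rankIn j F) (rankIn j' F)) := by
          funext t x
          cases x <;> rfl
        rw [hρ]
        exact hF.sat α hα
      have := ((h.holds_elem hdom).2 hmem).hom r
      rw [Atom.holds_map] at this
      have hρ : (fun t x => r.toFun t (h.elem (ρ t x) (hdom t _))) =
          withConst C fun t n => r.toFun t (h.elem (w j j' t n) (hdom t _)) := by
        funext t x
        cases x with
        | inl n => rfl
        | inr c => exact r.map_const c
      rwa [← hρ]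
    have := hq C hC.1 _ hsat
    exact fun heq => this ((congrArg (r.toFun s) h₁).trans (heq.trans (congrArg (r.toFun s) h₂.symm)))
  refine ⟨fun j => r.toFun s (h.elem (b j) (hdom s _)), fun j j' heq => ?_⟩
  obtain hlt | rfl | hlt := lt_trichotomy j j'
  · exact absurd heq (key j j' hlt)
  · rfl
  · exact absurd heq.symm (key j' j hlt)

open Cardinal in
theorem IsRetractor.card_le {T : Set (NegSentence L)} {C : Struc L} (hC : IsRetractor T C) :
    C.card ≤ 2 ^ L.card := by
  classical
  have h₀ := L.aleph0_le_card
  let o : ∀ s, C.carrier s := fun s => (C.nonempty_carrier s).some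
  have hs : ∀ s, #(C.carrier s) ≤ 2 ^ L.card := by
    intro s
    by_contra! hlt
    have hcol : ∀ x y : C.carrier s, ∃ q : Pattern L,
        x ≠ y → q.Separates T s ∧ ∃ e, q.Realizes C o x y e := by
      intro x y
      by_cases hxy : x = y
      -- The colour on the diagonal is irrelevant, as the homogeneous sequence has distinct terms.
      · exact ⟨⟨[], [], ⟨0⟩, ⟨0⟩⟩, fun h => absurd hxy h⟩
      · obtain ⟨q, hq⟩ := hC.isPCModel.exists_pattern o hxy
        exact ⟨q, fun _ => hq⟩
    choose c hc using hcol
    obtain ⟨q, a, ha⟩ := exists_homogeneous_seq h₀ L.mk_pattern_le_card hlt c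
    have hq : ∀ i j, i < j → q.Separates T s ∧ ∃ e, q.Realizes C o (a i) (a j) e := by
      intro i j hij
      obtain ⟨hne, hcq⟩ := ha i j hij
      exact hcq ▸ hc _ _ hne
    -- A well-order longer than the sort itself gives the contradiction.
    obtain ⟨b, hb⟩ := hC.exists_injective o (hq 0 1 one_pos).1 (fun i j hij => (hq i j hij).2)
      (Order.succ #(C.carrier s)).ord.ToType
    have := mk_le_of_injective hb
    rw [mk_ord_toType] at this
    exact (Order.lt_succ _).not_ge this
  rw [Struc.card, mk_sigma]
  refine (sum_le_sum _ (fun _ => 2 ^ L.card) hs).trans ?_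
  rw [sum_const']
  exact mul_le_of_le (h₀.trans (cantor _).le) (L.mk_sorts_le_card.trans (cantor _).le) le_rfl

end LocalLanguage

theorem mainTheorem8 (L : LocalLanguage.{u}) (T : Set (LocalLanguage.NegSentence L))
    (hT : LocalLanguage.IsNegLocalTheory T) (hsat : LocalLanguage.LocallySatisfiable T) :
    (∀ C : LocalLanguage.Struc L, LocalLanguage.IsRetractor T C → C.card ≤ 2 ^ L.card) ∧
    List.TFAE [
      LocalLanguage.HasRetractors T,
      ∃ κ : Cardinal.{u}, ∀ M : LocalLanguage.Struc L, LocalLanguage.IsPCModel T M → M.card < κ,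
      ∀ M : LocalLanguage.Struc L, LocalLanguage.IsPCModel T M → M.card ≤ 2 ^ L.card] := by
  refine ⟨fun C hC => hC.card_le, ?_⟩
  tfae_have 1 → 3 := fun h M hM => h.card_le (fun C hC => hC.card_le) hM
  tfae_have 3 → 2 := fun h => ⟨Order.succ (2 ^ L.card), fun M hM => Order.lt_succ_of_le (h M hM)⟩
  tfae_have 2 → 1 := fun ⟨_, hκ⟩ => LocalLanguage.hasRetractors_of_card_lt hκ
  tfae_finish
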